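/- **Setting.** Let $(F_\lambda)_{\lambda\in[a,b]}$ be a measurable family of non-arithmetic distribution functions on $[0,\infty)$ such that $\sup_\lambda F_\lambda(\delta)<1$ for some $\delta>0$ and $\inf_\lambda F_\lambda(K)>0$ for some $K<\infty$. Let $\Lambda_0,\Lambda_1,\dots$ be a Harris recurrent Markov chain on $[a,b]$ with transition kernel $g$ (for some nonzero $\sigma$-finite measure $\varphi$, every Borel set $B$ with $\varphi(B)>0$ is visited infinitely often almost surely from every starting point), with a spectral gap: the spectrum of $Pf(\lambda)=\int f(\lambda')\,g(\lambda,d\lambda')$ on the space of bounded measurable functions on $[a,b]$ is bounded away from the unit circle except for the eigenvalue $1$ and at most finitely many other eigenvalues on the unit circle. Let $\rho_s$ be its stationary probability measure. Given $(\Lambda_j)=(\lambda_j)$, let $X_{\Lambda_0},X_{\Lambda_1},\dots$ be independent, $X_{\Lambda_j}$ having distribution function $F_{\lambda_j}$; put $S_n=\sum_{j<n}X_{\Lambda_j}$, $S_0=0$, and, for $\Lambda_0=\lambda_0$, $$U_{\lambda_0}(t,A)=\sum_{n\ge 0}\mathbb P_{\lambda_0}(S_n\le t,\ \Lambda_n\in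 A).$$ Let $\mu_\lambda=\int_0^\infty x\,dF_\lambda(x)\in[0,\infty]$ and $\mu_{\rho_s}=\int_a^b\mu_\lambda\,d\rho_s(\lambda)$. A function $L$, positive on $(0,\infty)$, is slowly varying if $L(ct)/L(t)\to1$ as $t\to\infty$ for every $c>0$. The family is of scaled type if $0<a$ and $F_\lambda(t)=F(\lambda t)$ for all $\lambda\in[a,b]$, $t\ge0$, with a distribution function $F$ on $[0,\infty)$. **Theorem.** Let $A\subseteq[a,b]$ be a Borel set with $\rho_s(A)>0$ and let $\lambda_0\in[a,b]$. As $t\to\infty$: 1. If $\mu_{\rho_s}<\infty$, then $U_{\lambda_0}(t,A)\sim \dfrac{t}{\mu_{\rho_s}}\,\rho_s(A)$. 2. If the family is of scaled type and $1-F(t)=t^{-\alpha}L(t)$ for $t>0$, with $\alpha\in[0,1)$ and $L$ slowly varying, then $$U_{\lambda_0}(t,A)\sim\frac{t^\alpha}{L(t)}\,\frac{\sin(\pi\alpha)/(\pi\alpha)}{\int_a^b\lambda^{-\alpha}d\rho_s(\lambda)}\,\rho_s(A)=\frac{\sin(\pi\alpha)/(\pi\alpha)}{1-F(t)}\,\frac{\rho_s(A)}{\int_a^b\lambda^{-\alpha}d\rho_s(\lambda)},$$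 where $\sin(\pi\alpha)/(\pi\alpha)$ is read as $1$ for $\alpha=0$. 3. If the family is of scaled type and $1-F(t)=t^{-1}L(t)$ for $t>0$ with $L$ slowly varying, then $\tilde L(t)=\int_0^t(1-F(s))\,ds$ is slowly varying, $$U_{\lambda_0}(t,A)\sim\frac{t}{\tilde L(t)}\,\frac{\rho_s(A)}{\int_a^b\lambda^{-1}d\rho_s(\lambda)},$$ and $U_{\lambda_0}(t,A)\,(1-F(t))\to0$. -/

import Mathlib

open MeasureTheory ProbabilityTheory Filter Topology Asymptotics

namespace MarkovRenewal

noncomputable section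

/-! ### Markov chains -/

/-- The law, on the space of trajectories, of the homogeneous Markov chain `Λ₀, Λ₁, …` with
transition kernel `g` started from `Λ₀ = x`. -/
def chainLaw {S : Type*} [MeasurableSpace S] (g : Kernel S S) [IsMarkovKernel g] (x : S) :
    Measure (ℕ → S) :=
  Kernel.trajMeasure (X := fun _ => S) (Measure.dirac x)
    (fun n => g.comap (fun h : (Finset.Iic n) → S => h ⟨n, Finset.mem_Iic.2 le_rfl⟩)
      (measurable_pi_apply _))

instance {S : Type*} [MeasurableSpace S] (g : Kernel S S) [IsMarkovKernel g] (x : S) :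
    IsProbabilityMeasure (chainLaw g x) := by
  unfold chainLaw
  infer_instance

/-- Harris recurrence: for some nonzero `σ`-finite measure `φ`, every measurable set of positive
`φ`-measure is visited infinitely often, almost surely, from every starting point. -/
def HarrisRecurrent {S : Type*} [MeasurableSpace S] (g : Kernel S S) [IsMarkovKernel g] : Prop :=
  ∃ φ : Measure S, SigmaFinite φ ∧ φ ≠ 0 ∧
    ∀ B : Set S, MeasurableSet B → 0 < φ B →
      ∀ x : S, ∀ᵐ ω ∂(chainLaw g x), ∃ᶠ n in atTop, ω n ∈ B

/-- The space `L_∞` of all bounded measurable complex functions on `S` (functions, not classes). -/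
def boundedMeasurable (S : Type*) [MeasurableSpace S] : Submodule ℂ (S → ℂ) where
  carrier := {f | Measurable f ∧ ∃ C : ℝ, ∀ x, ‖f x‖ ≤ C}
  add_mem' := by
    rintro f h ⟨hf, C, hC⟩ ⟨hh, D, hD⟩
    exact ⟨hf.add hh, C + D, fun x => (norm_add_le _ _).trans (add_le_add (hC x) (hD x))⟩
  zero_mem' := ⟨measurable_const, 0, fun x => by simp⟩
  smul_mem' := by
    rintro c f ⟨hf, C, hC⟩
    refine ⟨hf.const_smul c, ‖c‖ * C, fun x => ?_⟩
    simp only [Pi.smul_apply, norm_smul]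
    exact mul_le_mul_of_nonneg_left (hC x) (norm_nonneg c)

theorem boundedMeasurable_integrable {S : Type*} [MeasurableSpace S]
    (f : boundedMeasurable S) (μ : Measure S) [IsFiniteMeasure μ] :
    Integrable (f : S → ℂ) μ := by
  obtain ⟨hf, C, hC⟩ := f.2
  exact Integrable.of_bound hf.aestronglyMeasurable C (Filter.Eventually.of_forall hC)

/-- The transition operator `(P f)(x) = ∫ f(y) g(x, dy)` on bounded measurable functions. -/
def transitionOp {S : Type*} [MeasurableSpace S] (g : Kernel S S) [IsMarkovKernel g] :
    Module.End ℂ (boundedMeasurable S) where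
  toFun f := ⟨fun x => ∫ y, (f : S → ℂ) y ∂(g x), by
    obtain ⟨hf, C, hC⟩ := f.2
    refine ⟨(hf.stronglyMeasurable.integral_kernel (κ := g)).measurable, C, fun x => ?_⟩
    refine (norm_integral_le_of_norm_le_const (Filter.Eventually.of_forall hC)).trans ?_
    simp⟩
  map_add' f h := by
    ext x
    exact integral_add (boundedMeasurable_integrable f _) (boundedMeasurable_integrable h _)
  map_smul' c f := by
    ext x
    exact integral_const_mul c _

/-- Spectral gap: the spectrum of the transition operator on `L_∞` is bounded away from the unit
circle, except for finitely many eigenvalues on the unit circle (the eigenvalue `1`, with the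
constants as eigenfunctions, is always among them). The spectrum is that of `P` as a linear map; by
the bounded inverse theorem this is its spectrum as a bounded operator on the Banach space `L_∞`
with the supremum norm. -/
def SpectralGap {S : Type*} [MeasurableSpace S] (g : Kernel S S) [IsMarkovKernel g] : Prop :=
  ∃ (E : Finset ℂ) (r : ℝ), r < 1 ∧
    (∀ z ∈ E, ‖z‖ = 1 ∧ (transitionOp g).HasEigenvalue z) ∧
    ∀ z ∈ spectrum ℂ (transitionOp g), z ∈ E ∨ ‖z‖ ≤ r

/-! ### Families of waiting time distributions -/

/-- A probability law on the line is non-arithmetic if it is not concentrated on a lattice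
`{0, ±h, ±2h, …}` with `h > 0`. -/
def NonArithmetic (μ : Measure ℝ) : Prop :=
  ∀ h : ℝ, 0 < h → ¬ ∀ᵐ x ∂μ, ∃ k : ℤ, x = k * h

/-- The basic assumptions on a measurable family of waiting time laws `η s` on `[0, ∞)`, whose
distribution functions are `F_s(t) = cdf (η s) t`. -/
structure BasicAssumptions {S : Type*} [MeasurableSpace S] (η : Kernel S ℝ) : Prop where
  nonneg : ∀ s, η s (Set.Iio 0) = 0
  nonArithmetic : ∀ s, NonArithmetic (η s)
  /-- `sup_s F_s(δ) < 1` for some `δ > 0`. -/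
  not_small : ∃ δ : ℝ, 0 < δ ∧ ∃ c : ℝ, c < 1 ∧ ∀ s, cdf (η s) δ ≤ c
  /-- `inf_s F_s(K) > 0` for some `K`. -/
  not_large : ∃ K : ℝ, 0 ≤ K ∧ ∃ c : ℝ, 0 < c ∧ ∀ s, c ≤ cdf (η s) K

/-- The family of laws `η l`, `l ∈ [a, b]`, is of scaled type with ancestor law `m`:
`F_l(t) = F(l t)` for `t ≥ 0`, where `F` is the distribution function of `m`. -/
def ScaledType {a b : ℝ} (η : Kernel (Set.Icc a b) ℝ) (m : Measure ℝ) : Prop :=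
  ∀ (l : Set.Icc a b) (t : ℝ), 0 ≤ t → cdf (η l) t = cdf m ((l : ℝ) * t)

/-- The stationary mean `∫ μ_s dρ(s)` of the waiting times, `μ_s = ∫ x dF_s(x)`, in `[0, ∞]`. -/
def meanWaiting {S : Type*} [MeasurableSpace S] (η : Kernel S ℝ) (ρ : Measure S) : ENNReal :=
  ∫⁻ s, ∫⁻ x, ENNReal.ofReal x ∂(η s) ∂ρ

/-! ### The Markov renewal process -/

/-- The law of the waiting times of the non-homogeneous renewal process with parameter sequence
`l₀, l₁, …`: independent variables, the `j`-th one with law `η (l j)`. As a kernel in the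
sequence. -/
def waitingLaw {S : Type*} [MeasurableSpace S] (η : Kernel S ℝ) [IsMarkovKernel η] :
    Kernel (ℕ → S) (ℕ → ℝ) where
  toFun l := Measure.infinitePi (fun j => η (l j))
  measurable' := by
    refine Measurable.measure_of_isPiSystem_of_isProbabilityMeasure
      (generateFrom_squareCylinders (α := fun _ : ℕ => ℝ)).symm
      (isPiSystem_squareCylinders (fun _ => MeasurableSpace.isPiSystem_measurableSet)
        (fun _ => by simp)) ?_
    rintro _ ⟨s, t, ht, rfl⟩
    have ht' : ∀ i, MeasurableSet (t i) := fun i => ht i (Set.mem_univ i)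
    simp_rw [Measure.infinitePi_pi _ (fun i _ => ht' i)]
    exact Finset.measurable_prod _ fun i _ =>
      (Kernel.measurable_coe η (ht' i)).comp (measurable_pi_apply i)

instance {S : Type*} [MeasurableSpace S] (η : Kernel S ℝ) [IsMarkovKernel η] :
    IsMarkovKernel (waitingLaw η) :=
  ⟨fun l => inferInstanceAs (IsProbabilityMeasure (Measure.infinitePi (fun j => η (l j))))⟩

/-- The joint law of the parameters `(Λ₀, Λ₁, …)` and of the waiting times
`(X_{Λ₀}, X_{Λ₁}, …)` of the Markov renewal process started from `Λ₀ = x`: the parameters form a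
Markov chain with kernel `g`, and given them the waiting times are those of the non-homogeneous
renewal process with this parameter sequence. -/
def law {S : Type*} [MeasurableSpace S] (g : Kernel S S) [IsMarkovKernel g]
    (η : Kernel S ℝ) [IsMarkovKernel η] (x : S) : Measure ((ℕ → S) × (ℕ → ℝ)) :=
  (chainLaw g x).compProd (waitingLaw η)

/-- The Markov renewal measure `U_x(t, A) = ∑_{n ≥ 0} P_x(S_n ≤ t, Λ_n ∈ A)`, where `S_n` is the sum
of the first `n` waiting times, that is, the expected number of renewals up to time `t`, the one at
time `0` included, whose parameter lies in `A`. -/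
def renewalMeasure {S : Type*} [MeasurableSpace S] (g : Kernel S S) [IsMarkovKernel g]
    (η : Kernel S ℝ) [IsMarkovKernel η] (x : S) (t : ℝ) (A : Set S) : ENNReal :=
  ∑' n : ℕ, law g η x {ω | ∑ j ∈ Finset.range n, ω.2 j ≤ t ∧ ω.1 n ∈ A}

/-- `L`, positive on `(0, ∞)`, varies slowly at infinity. -/
def SlowlyVarying (L : ℝ → ℝ) : Prop :=
  (∀ t, 0 < t → 0 < L t) ∧
    ∀ c : ℝ, 0 < c → Tendsto (fun t => L (c * t) / L t) atTop (𝓝 1)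

end

end MarkovRenewal

/-!
# Renewal theorems for Markov renewal processes

Let `φ_l(s)` be the Laplace transform of the waiting time law at `l`. Up to the factor `s`, the
Laplace transform of `t ↦ U_l(t, A)` is the Neumann series `R_s(l)` of the discounted transition
operator `f ↦ φ(s) · P f` (`lintegral_exp_mul_renewalMeasure`), and the first step of the process
gives the renewal equation `R_s = 1_A + φ(s) · P R_s` (`renewalLaplace_eq`).

Let `ψ(s)` be the order of magnitude of `1 - φ_l(s)` as `s → 0`: it is `s` if the stationary mean is
finite, and one minus the Laplace transform of the ancestor law for a family of scaled type. In both
cases `ψ(s) R_s` is bounded, so the renewal equation makes the functions `ψ(s) R_s` asymptotically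
harmonic. For a Harris recurrent chain with invariant probability measure `ρ` such a family is
asymptotically constant (`tendsto_sub_integral_of_asymptotically_harmonic`). This rests on two
facts. First, constants are the only invariant functions in `L²(ρ)`, so that a bounded
asymptotically harmonic family becomes orthogonal to the functions of mean zero, which are the
closure of the functions `P* v - v` (`tendsto_integral_mul_of_memLp`). Second, the law of the chain
at a late time has a small singular part with respect to `ρ` (`tendsto_singularPart_pow`), so that
weak convergence becomes convergence at each starting point.

The constant is found by integrating the renewal equation against `ρ`: the terms `∫ R_s` cancel and
`∫ (1 - φ_l(s)) P R_s(l) dρ(l) = ρ(A)` remains, whence `ψ(s) R_s(l) → ρ(A) / ∫ w dρ` with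
`w = lim (1 - φ(s)) / ψ(s)` (`tendsto_mul_of_renewal_equation`).

Karamata's Tauberian theorem (`tendsto_of_laplace_regularlyVarying`) converts this into the
asymptotics of `U`. For a family of scaled type, `ψ(1 / T)` is compared with the integrated tail
`∫₀ᵀ (1 - F)` by an Abelian theorem (`tendsto_one_sub_laplace_div`). The integrated tail is
asymptotic to `T (1 - F(T)) / (1 - α)` if `α < 1` (`tendsto_intervalIntegral_div`), and it is slowly
varying if `α = 1`, because `T (1 - F(T))` is then negligible in comparison
(`tendsto_mul_div_intervalIntegral`). Finally `Γ(1 + α) Γ(1 - α) = πα / sin(πα)`.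
-/

open scoped ENNReal

namespace MarkovRenewal

/-! ### Markov chains: the Markov property, invariant sets, asymptotic absolute continuity -/

section Invariant

variable {S : Type*} [MeasurableSpace S] {g : Kernel S S}

theorem invariant_pow {μ : Measure S} (h : Kernel.Invariant g μ) (n : ℕ) :
    Kernel.Invariant (g ^ n) μ := by
  induction n with
  | zero => rw [pow_zero]; exact Measure.id_comp
  | succ n ih => rw [pow_succ']; exact h.comp ih

theorem measure_invariant {μ : Measure S} (h : Kernel.Invariant g μ) (n : ℕ) {B : Set S}
    (hB : MeasurableSet B) : ∫⁻ x, (g ^ n) x B ∂μ = μ B := by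
  conv_rhs => rw [← (invariant_pow h n).def, Measure.bind_apply hB (Kernel.aemeasurable _)]

end Invariant

section Chain

variable {S : Type*} [MeasurableSpace S] (g : Kernel S S) [IsMarkovKernel g]

theorem chainLaw_map_zero (x : S) :
    (chainLaw g x).map (fun ω => ω 0) = Measure.dirac x := by
  unfold chainLaw Kernel.trajMeasure
  set κ : (n : ℕ) → Kernel ((i : Finset.Iic n) → S) S := fun n =>
    g.comap (fun h : (Finset.Iic n) → S => h ⟨n, Finset.mem_Iic.2 le_rfl⟩)
      (measurable_pi_apply _)
  have h := Kernel.traj_map_frestrictLe (X := fun _ => S) (κ := κ) 0 0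
  rw [Kernel.partialTraj_self] at h
  have h0 : (fun ω : ℕ → S => ω 0) =
      (fun y : (Finset.Iic 0) → S => y ⟨0, by simp⟩) ∘
        Preorder.frestrictLe (π := fun _ => S) 0 := by
    ext ω; rfl
  rw [h0, ← Measure.map_map (by fun_prop) (by fun_prop), Measure.map_comp _ _ (by fun_prop), h,
    Measure.id_comp, Measure.map_map (by fun_prop) (by fun_prop), Measure.map_dirac' (by fun_prop)]
  rfl

/-- The Markov property at time `n`, in integrated form. -/
theorem lintegral_chainLaw_succ (x : S) (n : ℕ) {F : ((i : Finset.Iic n) → S) → ℝ≥0∞}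
    (hF : Measurable F) {f : S → ℝ≥0∞} (hf : Measurable f) :
    ∫⁻ ω, F (Preorder.frestrictLe (π := fun _ => S) n ω) * f (ω (n + 1)) ∂(chainLaw g x) =
      ∫⁻ ω, F (Preorder.frestrictLe (π := fun _ => S) n ω) * ∫⁻ y, f y ∂(g (ω n))
        ∂(chainLaw g x) := by
  set κ : (n : ℕ) → Kernel ((i : Finset.Iic n) → S) S := fun n =>
    g.comap (fun h : (Finset.Iic n) → S => h ⟨n, Finset.mem_Iic.2 le_rfl⟩)
      (measurable_pi_apply _)
  have h := Kernel.map_frestrictLe_trajMeasure_compProd_eq_map_trajMeasure (X := fun _ => S)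
    (μ₀ := Measure.dirac x) (κ := κ) (a := n)
  have hm : Measurable fun p : ((i : Finset.Iic n) → S) × S => F p.1 * f p.2 := by fun_prop
  have h2 := congrArg (fun m => ∫⁻ p, F p.1 * f p.2 ∂m) h
  beta_reduce at h2
  rw [lintegral_map hm (by fun_prop), Measure.lintegral_compProd hm] at h2
  change _ = ∫⁻ ω, F (Preorder.frestrictLe (π := fun _ => S) n ω) * f (ω (n + 1))
    ∂(chainLaw g x) at h2
  rw [← h2, lintegral_map _ (by fun_prop)]
  · refine lintegral_congr fun ω => ?_
    exact lintegral_const_mul (F (Preorder.frestrictLe (π := fun _ => S) n ω)) hf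
  · exact hm.lintegral_kernel_prod_right'

/-- The law of the chain at time `n` is the `n`-th power of the transition kernel. -/
theorem lintegral_chainLaw_eval (x : S) (n : ℕ) : ∀ {f : S → ℝ≥0∞}, Measurable f →
    ∫⁻ ω, f (ω n) ∂(chainLaw g x) = ∫⁻ y, f y ∂((g ^ n) x) := by
  induction n with
  | zero =>
    intro f hf
    rw [← lintegral_map (f := f) (g := fun ω : ℕ → S => ω 0) hf (by fun_prop), chainLaw_map_zero,
      pow_zero]
    rfl
  | succ n ih =>
    intro f hf
    have := lintegral_chainLaw_succ g x n (F := fun _ => 1) measurable_const hf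
    simp only [one_mul] at this
    rw [this, ih (hf.lintegral_kernel), pow_succ']
    exact (Kernel.lintegral_comp _ _ _ hf).symm

theorem chainLaw_eval (x : S) (n : ℕ) {B : Set S} (hB : MeasurableSet B) :
    chainLaw g x {ω | ω n ∈ B} = (g ^ n) x B := by
  have h := lintegral_chainLaw_eval g x n (measurable_one.indicator hB)
  rw [lintegral_indicator_one hB] at h
  rw [← h]
  exact (lintegral_indicator_one (μ := chainLaw g x)
    (hB.preimage (measurable_pi_apply (X := fun _ : ℕ => S) n))).symm

instance isMarkovKernel_pow (n : ℕ) : IsMarkovKernel (g ^ n) := by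
  induction n with
  | zero => rw [pow_zero]; exact inferInstanceAs (IsMarkovKernel (Kernel.id : Kernel S S))
  | succ n ih => rw [pow_succ']; exact inferInstanceAs (IsMarkovKernel (g ∘ₖ (g ^ n)))

variable {g}

/-- A set that is visited almost surely can be reached with positive probability. -/
theorem exists_pow_pos_of_frequently {x : S} {B : Set S} (hB : MeasurableSet B)
    (h : ∀ᵐ ω ∂(chainLaw g x), ∃ᶠ n in atTop, ω n ∈ B) : ∃ n, 0 < (g ^ n) x B := by
  by_contra! hcon
  have h1 : ∀ n, ∀ᵐ ω ∂(chainLaw g x), ω n ∉ B := fun n => by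
    rw [ae_iff]
    simp only [not_not]
    rw [chainLaw_eval g x n hB]
    exact le_antisymm (hcon n) zero_le
  have h2 : ∀ᵐ ω ∂(chainLaw g x), False := by
    filter_upwards [h, ae_all_iff.2 h1] with ω hω hω'
    obtain ⟨n, hn⟩ := hω.exists
    exact hω' n hn
  exact h2.exists.elim fun _ h => h

/-- Zero-one law: a set which the stationary chain of a Harris recurrent kernel neither enters nor
leaves has measure zero or one. -/
theorem measure_eq_zero_or_of_invariant (hH : HarrisRecurrent g) {ρ : Measure S}
    [IsProbabilityMeasure ρ] (hρ : Kernel.Invariant g ρ) {B : Set S} (hB : MeasurableSet B)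
    (hinv : ∀ᵐ p ∂(ρ ⊗ₘ g), p.1 ∈ B ↔ p.2 ∈ B) : ρ B = 0 ∨ ρ Bᶜ = 0 := by
  obtain ⟨φ, -, hφ0, hφ⟩ := hH
  have key : ∀ C : Set S, MeasurableSet C → (∀ᵐ p ∂(ρ ⊗ₘ g), p.1 ∈ C ↔ p.2 ∈ C) → 0 < φ C →
      ρ Cᶜ = 0 := by
    intro C hC hCinv hφC
    -- the restriction of `ρ` to the complement of an invariant set is again invariant
    have hinv' : Kernel.Invariant g (ρ.restrict Cᶜ) := by
      ext D hD
      rw [Measure.bind_apply hD (Kernel.aemeasurable _), Measure.restrict_apply hD]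
      rw [← Measure.compProd_apply_prod hC.compl hD]
      have h1 : (ρ ⊗ₘ g) (Cᶜ ×ˢ D) = (ρ ⊗ₘ g) (Set.univ ×ˢ (D ∩ Cᶜ)) := by
        refine measure_congr ?_
        filter_upwards [hCinv] with p hp
        apply propext
        change (p.1 ∉ C ∧ p.2 ∈ D) ↔ (True ∧ p.2 ∈ D ∧ p.2 ∉ C)
        tauto
      rw [h1, Measure.compProd_apply_prod MeasurableSet.univ (hD.inter hC.compl),
        Measure.restrict_univ]
      conv_rhs => rw [← hρ.def, Measure.bind_apply (hD.inter hC.compl) (Kernel.aemeasurable _)]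
    have h0 : ∀ n, ∀ᵐ x ∂(ρ.restrict Cᶜ), (g ^ n) x C = 0 := fun n => by
      have := measure_invariant hinv' n hC
      rw [Measure.restrict_apply hC, Set.inter_compl_self, measure_empty,
        lintegral_eq_zero_iff (Kernel.measurable_coe _ hC)] at this
      exact this
    have h1 : ∀ᵐ x ∂(ρ.restrict Cᶜ), False := by
      filter_upwards [ae_all_iff.2 h0] with x hx
      obtain ⟨n, hn⟩ := exists_pow_pos_of_frequently hC (hφ C hC hφC x)
      exact hn.ne' (hx n)
    simpa [ae_iff, Measure.restrict_apply] using h1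
  by_cases h : 0 < φ B
  · exact Or.inr (key B hB hinv h)
  · left
    have : 0 < φ Bᶜ := by
      by_contra h'
      apply hφ0
      rw [← Measure.measure_univ_eq_zero, ← Set.union_compl_self B]
      exact measure_union_null (by simpa using h) (by simpa using h')
    have := key Bᶜ hB.compl (by filter_upwards [hinv] with p hp; simp [hp]) this
    rwa [compl_compl] at this

/-- The law of a Harris recurrent chain at time `n`, started from any point, becomes asymptotically
absolutely continuous with respect to the invariant probability measure. -/
theorem tendsto_singularPart_pow (hH : HarrisRecurrent g) {ρ : Measure S}
    [IsProbabilityMeasure ρ] (hρ : Kernel.Invariant g ρ) (x : S) :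
    Tendsto (fun n => ((g ^ n) x).singularPart ρ Set.univ) atTop (𝓝 0) := by
  obtain ⟨φ, -, hφ0, hφ⟩ := hH
  have hφρ : φ ≪ ρ := by
    refine Measure.AbsolutelyContinuous.mk fun B hB h0 => ?_
    by_contra hne
    have h1 : ∀ n, ∀ᵐ y ∂ρ, (g ^ n) y B = 0 := fun n => by
      have := measure_invariant hρ n hB
      rwa [h0, lintegral_eq_zero_iff (Kernel.measurable_coe _ hB)] at this
    have h2 : ∀ᵐ y ∂ρ, False := by
      filter_upwards [ae_all_iff.2 h1] with y hy
      obtain ⟨n, hn⟩ := exists_pow_pos_of_frequently hB (hφ B hB (pos_iff_ne_zero.2 hne) y)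
      exact hn.ne' (hy n)
    exact h2.exists.elim fun _ h => h
  have hms := fun n => Measure.mutuallySingular_singularPart ((g ^ n) x) ρ
  -- `N` is a null set carrying the singular parts of all the laws
  set N : Set S := ⋃ n, ((hms n).nullSet)ᶜ with hN
  have hNm : MeasurableSet N := MeasurableSet.iUnion fun n => (hms n).measurableSet_nullSet.compl
  have hN0 : ρ N = 0 := measure_iUnion_null fun n => (hms n).measure_compl_nullSet
  -- `N'` is the set of the points from which `N` can be reached; its complement is absorbing
  set N' : Set S := {y | ∃ n, (g ^ n) y N ≠ 0} with hN'
  have hN'm : MeasurableSet N' := by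
    have : N' = ⋃ n, {y | (g ^ n) y N ≠ 0} := by ext; simp [hN']
    rw [this]
    exact MeasurableSet.iUnion fun n =>
      (Kernel.measurable_coe _ hNm) (measurableSet_singleton (0 : ℝ≥0∞)).compl
  have hN'0 : ρ N' = 0 := by
    have h1 : ∀ n, ∀ᵐ y ∂ρ, (g ^ n) y N = 0 := fun n => by
      have := measure_invariant hρ n hNm
      rwa [hN0, lintegral_eq_zero_iff (Kernel.measurable_coe _ hNm)] at this
    have h2 : ∀ᵐ y ∂ρ, y ∉ N' := by
      filter_upwards [ae_all_iff.2 h1] with y hy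
      simpa [hN'] using hy
    simpa [ae_iff] using h2
  have hsub : N ⊆ N' := fun y hy => ⟨0, by
    rw [pow_zero]
    change (Measure.dirac y) N ≠ 0
    rw [Measure.dirac_apply' _ hNm]
    simp [hy]⟩
  have habs : ∀ y, y ∉ N' → g y N' = 0 := by
    intro y hy
    have h1 : ∀ n, ∀ᵐ z ∂(g y), (g ^ n) z N = 0 := fun n => by
      have h3 : (g ^ (n + 1)) y N = 0 := by
        by_contra h; exact hy ⟨n + 1, h⟩
      rw [pow_succ] at h3
      change ((g ^ n) ∘ₖ g) y N = 0 at h3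
      rwa [Kernel.comp_apply' _ _ _ hNm, lintegral_eq_zero_iff (Kernel.measurable_coe _ hNm)] at h3
    have h2 : ∀ᵐ z ∂(g y), z ∉ N' := by
      filter_upwards [ae_all_iff.2 h1] with z hz
      simpa [hN'] using hz
    simpa [ae_iff] using h2
  -- the chain enters the complement of `N'` almost surely and stays there
  set V : ℕ → Set (ℕ → S) := fun n => {ω | ω n ∈ N'} with hV
  have hstay : ∀ n, ∀ᵐ ω ∂(chainLaw g x), ω (n + 1) ∈ N' → ω n ∈ N' := by
    intro n
    have h := lintegral_chainLaw_succ g x n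
      (F := ({h | h ⟨n, Finset.mem_Iic.2 le_rfl⟩ ∈ N'ᶜ} :
        Set ((i : Finset.Iic n) → S)).indicator (fun _ => (1 : ℝ≥0∞)))
      (measurable_one.indicator (hN'm.compl.preimage (measurable_pi_apply _)))
      (measurable_one.indicator hN'm)
    have h0 : ∀ ω : ℕ → S, (({h | h ⟨n, Finset.mem_Iic.2 le_rfl⟩ ∈ N'ᶜ} :
        Set ((i : Finset.Iic n) → S)).indicator (fun _ => (1 : ℝ≥0∞)))
        (Preorder.frestrictLe (π := fun _ => S) n ω) * ∫⁻ y, N'.indicator 1 y ∂(g (ω n)) = 0 := by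
      intro ω
      rw [lintegral_indicator_one hN'm]
      by_cases hω : ω n ∈ N'
      · rw [Set.indicator_of_notMem (by simpa using hω), zero_mul]
      · rw [habs _ hω, mul_zero]
    simp_rw [h0] at h
    rw [lintegral_zero, lintegral_eq_zero_iff] at h
    · filter_upwards [h] with ω hω h1
      by_contra h2
      simp only [Pi.zero_apply, mul_eq_zero, Set.indicator_apply_eq_zero, Pi.one_apply,
        one_ne_zero, imp_false] at hω
      rcases hω with hω | hω
      · exact hω h2
      · exact hω h1
    · exact ((measurable_one.indicator (hN'm.compl.preimage (measurable_pi_apply _))).comp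
        (by fun_prop)).mul ((measurable_one.indicator hN'm).comp (measurable_pi_apply _))
  have hanti : ∀ᵐ ω ∂(chainLaw g x), ∀ m n, m ≤ n → ω n ∈ N' → ω m ∈ N' := by
    filter_upwards [ae_all_iff.2 hstay] with ω hω m n hmn
    induction hmn with
    | refl => exact id
    | step _ ih => exact fun h => ih (hω _ h)
  have hvis : ∀ᵐ ω ∂(chainLaw g x), ∃ n, ω n ∉ N' := by
    have hpos : 0 < φ N'ᶜ := by
      rw [pos_iff_ne_zero]
      intro h'
      apply hφ0
      rw [← Measure.measure_univ_eq_zero, ← Set.union_compl_self N']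
      exact measure_union_null (hφρ hN'0) h'
    filter_upwards [hφ _ hN'm.compl hpos x] with ω hω
    exact hω.exists
  have hlim : Tendsto (fun n => (g ^ n) x N') atTop (𝓝 0) := by
    have h1 : Tendsto (fun n => ∫⁻ ω, (V n).indicator 1 ω ∂(chainLaw g x)) atTop
        (𝓝 (∫⁻ _, 0 ∂(chainLaw g x))) := by
      refine tendsto_lintegral_of_dominated_convergence (fun _ => 1)
        (fun n => measurable_one.indicator
          (hN'm.preimage (measurable_pi_apply (X := fun _ : ℕ => S) n)))
        (fun n => Eventually.of_forall fun ω => Set.indicator_le_self' (by simp) _) (by simp) ?_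
      filter_upwards [hanti, hvis] with ω h2 ⟨m, hm⟩
      refine tendsto_const_nhds.congr' ?_
      filter_upwards [eventually_ge_atTop m] with n hn
      rw [Set.indicator_of_notMem]
      exact fun h => hm (h2 m n hn h)
    simp_rw [lintegral_zero] at h1
    refine h1.congr fun n => ?_
    rw [← chainLaw_eval g x n hN'm]
    exact lintegral_indicator_one (μ := chainLaw g x)
      (hN'm.preimage (measurable_pi_apply (X := fun _ : ℕ => S) n))
  refine tendsto_of_tendsto_of_tendsto_of_le_of_le tendsto_const_nhds hlim (fun _ => zero_le)
    fun n => ?_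
  have h3 : ((g ^ n) x).singularPart ρ Nᶜ = 0 := by
    refine measure_mono_null ?_ (hms n).measure_nullSet
    rw [hN, Set.compl_iUnion]
    exact (Set.iInter_subset _ n).trans (by simp)
  calc ((g ^ n) x).singularPart ρ Set.univ
      = ((g ^ n) x).singularPart ρ N := by
        rw [← measure_add_measure_compl hNm (μ := ((g ^ n) x).singularPart ρ), h3, add_zero]
    _ ≤ (g ^ n) x N := Measure.singularPart_le _ _ _
    _ ≤ (g ^ n) x N' := measure_mono hsub

end Chain

/-! ### Asymptotically harmonic functions and the renewal equation -/

section Ergodic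

variable {S : Type*} [MeasurableSpace S] {g : Kernel S S} [IsMarkovKernel g]

theorem measurePreserving_fst_compProd {ρ : Measure S} [IsProbabilityMeasure ρ] :
    MeasurePreserving Prod.fst (ρ ⊗ₘ g) ρ :=
  ⟨measurable_fst, Measure.fst_compProd ρ g⟩

theorem measurePreserving_snd_compProd {ρ : Measure S} [IsProbabilityMeasure ρ]
    (hρ : Kernel.Invariant g ρ) : MeasurePreserving Prod.snd (ρ ⊗ₘ g) ρ :=
  ⟨measurable_snd, (Measure.snd_compProd ρ g).trans hρ⟩

/-- An integrable function of mean zero whose values at consecutive points of the stationary chain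
agree vanishes. -/
theorem ae_eq_zero_of_fst_eq_snd (hH : HarrisRecurrent g) {ρ : Measure S}
    [IsProbabilityMeasure ρ] (hρ : Kernel.Invariant g ρ) {w : S → ℝ} (hw : Measurable w)
    (hwi : Integrable w ρ) (h0 : ∫ x, w x ∂ρ = 0) (hinv : ∀ᵐ p ∂(ρ ⊗ₘ g), w p.1 = w p.2) :
    w =ᵐ[ρ] 0 := by
  have hB : MeasurableSet {x | 0 < w x} := measurableSet_lt measurable_const hw
  rcases measure_eq_zero_or_of_invariant hH hρ hB
    (by filter_upwards [hinv] with p hp; simp [hp]) with h | h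
  · have h1 : 0 ≤ᵐ[ρ] fun x => - w x := by
      have : ∀ᵐ x ∂ρ, ¬ 0 < w x := by simpa [ae_iff] using h
      filter_upwards [this] with x hx
      simpa using hx
    have h2 := (integral_eq_zero_iff_of_nonneg_ae h1 hwi.neg).1 (by rw [integral_neg, h0, neg_zero])
    filter_upwards [h2] with x hx
    simpa using hx
  · have h1 : ∀ᵐ x ∂ρ, 0 < w x := h
    exact (integral_eq_zero_iff_of_nonneg_ae (h1.mono fun x hx => hx.le) hwi).1 h0

theorem integrable_of_bdd {T : Type*} [MeasurableSpace T] {μ : Measure T} [IsFiniteMeasure μ]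
    {f : T → ℝ} (hf : Measurable f) {C : ℝ} (hC : ∀ x, |f x| ≤ C) : Integrable f μ :=
  Integrable.of_bound hf.aestronglyMeasurable C (Eventually.of_forall hC)

theorem abs_integral_le_of_bdd {T : Type*} [MeasurableSpace T] {μ : Measure T}
    [IsProbabilityMeasure μ] {f : T → ℝ} {C : ℝ} (hC : ∀ x, |f x| ≤ C) : |∫ x, f x ∂μ| ≤ C := by
  have := norm_integral_le_of_norm_le_const (μ := μ) (f := f) (Eventually.of_forall hC)
  simpa using this

theorem abs_sub_integral_le_of_bdd {T : Type*} [MeasurableSpace T] {μ : Measure T}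
    [IsProbabilityMeasure μ] {f : T → ℝ} {C : ℝ} (hC : ∀ x, |f x| ≤ C) (x : T) :
    |f x - ∫ y, f y ∂μ| ≤ 2 * |C| := by
  calc |f x - ∫ y, f y ∂μ| ≤ |f x| + |∫ y, f y ∂μ| := abs_sub _ _
    _ ≤ 2 * |C| := by linarith [hC x, abs_integral_le_of_bdd (μ := μ) hC, le_abs_self C]

theorem integral_invariant {ρ : Measure S} [IsProbabilityMeasure ρ]
    (hρ : Kernel.Invariant g ρ) {f : S → ℝ} (hf : Measurable f) {C : ℝ} (hC : ∀ x, |f x| ≤ C) :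
    ∫ x, ∫ y, f y ∂(g x) ∂ρ = ∫ x, f x ∂ρ := by
  have h2 : ∫ p, f p.2 ∂(ρ ⊗ₘ g) = ∫ x, f x ∂ρ := by
    rw [← (measurePreserving_snd_compProd hρ).map_eq, integral_map (by fun_prop)
      hf.aestronglyMeasurable]
    rw [(measurePreserving_snd_compProd hρ).map_eq]
  rw [← h2, Measure.integral_compProd (f := fun p => f p.2)
    (integrable_of_bdd (hf.comp measurable_snd) fun p => hC p.2)]

variable {ι : Type*} {l : Filter ι} [l.IsCountablyGenerated]

/-- Weak convergence in `L²`: a bounded family of functions which is asymptotically harmonic for a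
Harris recurrent kernel becomes asymptotically orthogonal to all the functions of mean zero. The
square integrable functions tested by such a family in the desired way form a subspace, and this
subspace is dense since it contains the constants and all `P* v - v`. -/
theorem tendsto_integral_mul_of_memLp (hH : HarrisRecurrent g) {ρ : Measure S}
    [IsProbabilityMeasure ρ] (hρ : Kernel.Invariant g ρ) {h : ι → S → ℝ}
    (hm : ∀ i, Measurable (h i)) {C : ℝ} (hC : ∀ i x, |h i x| ≤ C)
    (hharm : ∀ x, Tendsto (fun i => h i x - ∫ y, h i y ∂(g x)) l (𝓝 0))
    {u : S → ℝ} (hu : MemLp u 2 ρ) :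
    Tendsto (fun i => ∫ x, u x * (h i x - ∫ y, h i y ∂ρ) ∂ρ) l (𝓝 0) := by
  set k : ι → S → ℝ := fun i x => h i x - ∫ y, h i y ∂ρ with hk
  have hkm : ∀ i, Measurable (k i) := fun i => (hm i).sub_const _
  have hkC : ∀ i x, |k i x| ≤ 2 * |C| := fun i => abs_sub_integral_le_of_bdd (hC i)
  have hkL : ∀ i, MemLp (k i) 2 ρ := fun i =>
    MemLp.of_bound (hkm i).aestronglyMeasurable (2 * |C|) (Eventually.of_forall (hkC i))
  set kL : ι → Lp ℝ 2 ρ := fun i => (hkL i).toLp with hkLdef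
  have hnorm : ∀ i, ‖kL i‖ ≤ 2 * |C| := fun i => by
    have h1 := Lp.norm_le_of_ae_bound (f := kL i) (C := 2 * |C|) (by positivity) (by
      filter_upwards [(hkL i).coeFn_toLp] with x hx
      rw [hx]
      exact hkC i x)
    simpa [measureUnivNNReal] using h1
  -- the test functions with the desired limit; the subspace is closed as the family is bounded
  let K : Submodule ℝ (Lp ℝ 2 ρ) :=
    { carrier := {v | Tendsto (fun i => inner ℝ (kL i) v) l (𝓝 0)}
      add_mem' := fun {v w} hv hw => by
        have := Tendsto.add hv hw
        rw [add_zero] at this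
        exact this.congr fun i => (inner_add_right _ _ _).symm
      zero_mem' := by
        refine tendsto_const_nhds.congr fun i => ?_
        rw [inner_zero_right]
      smul_mem' := fun c v hv => by
        have := Tendsto.const_mul c hv
        rw [mul_zero] at this
        exact this.congr fun i => (real_inner_smul_right _ _ _).symm }
  have hclosed : K.topologicalClosure ≤ K := by
    intro v hv
    rw [← SetLike.mem_coe, Submodule.topologicalClosure_coe, Metric.mem_closure_iff] at hv
    change Tendsto (fun i => inner ℝ (kL i) v) l (𝓝 0)
    rw [Metric.tendsto_nhds]
    intro ε hε
    obtain ⟨w, hw, hvw⟩ := hv (ε / (2 * (2 * |C| + 1))) (by positivity)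
    have hw' : Tendsto (fun i => inner ℝ (kL i) w) l (𝓝 0) := hw
    filter_upwards [(Metric.tendsto_nhds.1 hw') (ε / 2) (by positivity)] with i hi
    rw [Real.dist_eq, sub_zero] at hi ⊢
    have h1 : inner ℝ (kL i) v = inner ℝ (kL i) (v - w) + inner ℝ (kL i) w := by
      rw [← inner_add_right, sub_add_cancel]
    have h2 : |inner ℝ (kL i) (v - w)| ≤ ε / 2 := by
      calc |inner ℝ (kL i) (v - w)| ≤ ‖kL i‖ * ‖v - w‖ := abs_real_inner_le_norm _ _
        _ ≤ (2 * |C| + 1) * (ε / (2 * (2 * |C| + 1))) := by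
          refine mul_le_mul (by linarith [hnorm i]) ?_ (norm_nonneg _) (by positivity)
          rw [← dist_eq_norm]; exact hvw.le
        _ = ε / 2 := by field_simp
    rw [h1]
    exact (abs_add_le _ _).trans_lt (by linarith)
  -- `J0` and `J1` read off a function at two consecutive points of the stationary chain, so that
  -- the transition operator on `L²(ρ)` is `J0† J1` and its adjoint is `J1† J0`
  set J0 := Lp.compMeasurePreservingₗᵢ ℝ (E := ℝ) (p := 2) Prod.fst
    (measurePreserving_fst_compProd (g := g) (ρ := ρ)) with hJ0
  set J1 := Lp.compMeasurePreservingₗᵢ ℝ (E := ℝ) (p := 2) Prod.snd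
    (measurePreserving_snd_compProd hρ) with hJ1
  have hJ0c : ∀ v : Lp ℝ 2 ρ, J0 v =ᵐ[ρ ⊗ₘ g] fun p => v p.1 := fun v =>
    Lp.coeFn_compMeasurePreserving v measurePreserving_fst_compProd
  have hJ1c : ∀ v : Lp ℝ 2 ρ, J1 v =ᵐ[ρ ⊗ₘ g] fun p => v p.2 := fun v =>
    Lp.coeFn_compMeasurePreserving v (measurePreserving_snd_compProd hρ)
  have hone : Lp.const 2 ρ (1 : ℝ) ∈ K := by
    change Tendsto _ l (𝓝 0)
    refine tendsto_const_nhds.congr fun i => ?_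
    rw [L2.inner_def]
    have : ∫ x, k i x ∂ρ = 0 := by
      rw [hk, integral_sub (integrable_of_bdd (hm i) (hC i)) (integrable_const _)]
      simp
    rw [← this]
    refine integral_congr_ae ?_
    filter_upwards [(hkL i).coeFn_toLp, Lp.coeFn_const (μ := ρ) (p := 2) (1 : ℝ)] with x h1 h2
    rw [h2, h1]
    simp
  have hcob : ∀ v : Lp ℝ 2 ρ, J1.toContinuousLinearMap.adjoint (J0 v) - v ∈ K := by
    intro v
    change Tendsto _ l (𝓝 0)
    have hvi : Integrable v ρ := (Lp.memLp v).integrable (by norm_num)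
    have hform : ∀ i, ∫ x, v x * ((∫ y, h i y ∂(g x)) - h i x) ∂ρ =
        inner ℝ (kL i) (J1.toContinuousLinearMap.adjoint (J0 v) - v) := by
      intro i
      rw [inner_sub_right, ContinuousLinearMap.adjoint_inner_right]
      have e1 : inner ℝ (kL i) v = inner ℝ (J0 (kL i)) (J0 v) := (J0.inner_map_map _ _).symm
      rw [e1, ← inner_sub_left]
      rw [L2.inner_def]
      have hk0 : ∀ᵐ p ∂(ρ ⊗ₘ g), (kL i) p.1 = k i p.1 :=
        (measurePreserving_fst_compProd (g := g) (ρ := ρ)).quasiMeasurePreserving.ae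
          (hkL i).coeFn_toLp
      have hk1 : ∀ᵐ p ∂(ρ ⊗ₘ g), (kL i) p.2 = k i p.2 :=
        (measurePreserving_snd_compProd hρ).quasiMeasurePreserving.ae (hkL i).coeFn_toLp
      have e2 : ∫ p, inner ℝ ((J1.toContinuousLinearMap (kL i) - J0 (kL i) : Lp ℝ 2 (ρ ⊗ₘ g)) p)
          ((J0 v) p) ∂(ρ ⊗ₘ g) = ∫ p, v p.1 * (h i p.2 - h i p.1) ∂(ρ ⊗ₘ g) := by
        refine integral_congr_ae ?_
        filter_upwards [hk0, hk1, hJ0c v, hJ0c (kL i), hJ1c (kL i),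
          Lp.coeFn_sub (J1 (kL i)) (J0 (kL i))] with p h1 h2 h3 h4 h5 h6
        change inner ℝ ((J1 (kL i) - J0 (kL i) : Lp ℝ 2 (ρ ⊗ₘ g)) p) ((J0 v) p) = _
        rw [h6, Pi.sub_apply, h5, h4, h3, h1, h2]
        simp [hk]
      rw [e2, Measure.integral_compProd]
      · refine integral_congr_ae (Eventually.of_forall fun x => ?_)
        change _ = ∫ y, v x * (h i y - h i x) ∂(g x)
        rw [integral_const_mul, integral_sub (integrable_of_bdd (hm i) (hC i)) (integrable_const _)]
        simp
      · have hvi' : Integrable (fun p : S × S => v p.1) (ρ ⊗ₘ g) :=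
          (measurePreserving_fst_compProd (g := g) (ρ := ρ)).integrable_comp_of_integrable hvi
        refine hvi'.mul_bdd (c := 2 * C) ?_ ?_
        · exact (((hm i).comp measurable_snd).sub ((hm i).comp measurable_fst)).aestronglyMeasurable
        · refine Eventually.of_forall fun p => ?_
          calc |h i p.2 - h i p.1| ≤ |h i p.2| + |h i p.1| := abs_sub _ _
            _ ≤ 2 * C := by linarith [hC i p.1, hC i p.2]
    refine Tendsto.congr hform ?_
    have hz : (0 : ℝ) = ∫ x, (0 : ℝ) ∂ρ := by simp
    rw [hz]
    refine tendsto_integral_filter_of_dominated_convergence (fun x => |v x| * (2 * C)) ?_ ?_ ?_ ?_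
    · refine Eventually.of_forall fun i => ?_
      exact hvi.aestronglyMeasurable.mul
        (((hm i).stronglyMeasurable.integral_kernel (κ := g)).measurable.sub
          (hm i)).aestronglyMeasurable
    · refine Eventually.of_forall fun i => Eventually.of_forall fun x => ?_
      rw [norm_mul, Real.norm_eq_abs, Real.norm_eq_abs]
      refine mul_le_mul_of_nonneg_left ?_ (abs_nonneg _)
      calc |(∫ y, h i y ∂(g x)) - h i x| ≤ |∫ y, h i y ∂(g x)| + |h i x| := abs_sub _ _
        _ ≤ 2 * C := by linarith [hC i x, abs_integral_le_of_bdd (μ := g x) (hC i)]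
    · exact hvi.abs.mul_const _
    · refine Eventually.of_forall fun x => ?_
      have := ((hharm x).neg).const_mul (v x)
      rw [neg_zero, mul_zero] at this
      refine this.congr fun i => by ring
  have hperp : Kᗮ = ⊥ := by
    rw [Submodule.eq_bot_iff]
    intro w hw
    rw [Submodule.mem_orthogonal'] at hw
    have h1 : inner ℝ (J0 w) (J1 w) = ‖w‖ ^ 2 := by
      have := hw _ (hcob w)
      rw [inner_sub_right, ContinuousLinearMap.adjoint_inner_right, real_inner_self_eq_norm_sq,
        sub_eq_zero, real_inner_comm] at this
      exact this
    -- equality in the Cauchy–Schwarz inequality, since `J0` and `J1` are isometries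
    have h2 : J0 w = J1 w := by
      rw [← sub_eq_zero, ← norm_eq_zero, ← sq_eq_zero_iff, norm_sub_sq_real, h1,
        J0.norm_map, J1.norm_map]
      ring
    have hwi : Integrable w ρ := (Lp.memLp w).integrable (by norm_num)
    have hw0 : ∫ x, w x ∂ρ = 0 := by
      have h3 := hw _ hone
      rw [L2.inner_def] at h3
      rw [← h3]
      refine integral_congr_ae ?_
      filter_upwards [Lp.coeFn_const (μ := ρ) (p := 2) (1 : ℝ)] with x h2
      rw [h2]
      simp
    have h4 := ae_eq_zero_of_fst_eq_snd hH hρ (Lp.stronglyMeasurable w).measurable hwi hw0 (by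
      filter_upwards [hJ0c w, hJ1c w] with p h5 h6
      rw [← h5, ← h6, h2])
    exact Lp.eq_zero_iff_ae_eq_zero.2 h4
  have htop : K = ⊤ := by
    rw [← Submodule.topologicalClosure_eq_top_iff] at hperp
    exact top_le_iff.1 (hperp ▸ hclosed)
  have hmem : hu.toLp ∈ K := by rw [htop]; trivial
  change Tendsto (fun i => inner ℝ (kL i) hu.toLp) l (𝓝 0) at hmem
  refine hmem.congr fun i => ?_
  rw [L2.inner_def]
  refine integral_congr_ae ?_
  filter_upwards [(hkL i).coeFn_toLp, hu.coeFn_toLp] with x h1 h2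
  rw [h1, h2]
  simp [hk]

/-- Extension of the weak convergence from square integrable to integrable test functions. -/
theorem tendsto_integral_mul_of_integrable (hH : HarrisRecurrent g) {ρ : Measure S}
    [IsProbabilityMeasure ρ] (hρ : Kernel.Invariant g ρ) {h : ι → S → ℝ}
    (hm : ∀ i, Measurable (h i)) {C : ℝ} (hC : ∀ i x, |h i x| ≤ C)
    (hharm : ∀ x, Tendsto (fun i => h i x - ∫ y, h i y ∂(g x)) l (𝓝 0))
    {u : S → ℝ} (hu : Integrable u ρ) :
    Tendsto (fun i => ∫ x, u x * (h i x - ∫ y, h i y ∂ρ) ∂ρ) l (𝓝 0) := by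
  set k : ι → S → ℝ := fun i x => h i x - ∫ y, h i y ∂ρ with hk
  have hkm : ∀ i, Measurable (k i) := fun i => (hm i).sub_const _
  have hkC : ∀ i x, |k i x| ≤ 2 * |C| := fun i => abs_sub_integral_le_of_bdd (hC i)
  have hint : ∀ i {v : S → ℝ}, Integrable v ρ → Integrable (fun x => v x * k i x) ρ :=
    fun i v hv => hv.mul_bdd (c := 2 * |C|) (hkm i).aestronglyMeasurable
      (Eventually.of_forall (hkC i))
  refine Integrable.induction (fun u : S → ℝ => Tendsto (fun i => ∫ x, u x * k i x ∂ρ) l (𝓝 0))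
    ?_ ?_ ?_ ?_ hu
  · intro c s hs _
    exact tendsto_integral_mul_of_memLp hH hρ hm hC hharm (memLp_indicator_const 2 hs c
      (Or.inr (measure_ne_top _ _)))
  · intro f₁ f₂ _ hf hg h1 h2
    have := h1.add h2
    rw [add_zero] at this
    refine this.congr fun i => ?_
    rw [← integral_add (hint i hf) (hint i hg)]
    simp [add_mul]
  · refine isClosed_of_closure_subset fun v hv => ?_
    rw [Metric.mem_closure_iff] at hv
    change Tendsto (fun i => ∫ x, v x * k i x ∂ρ) l (𝓝 0)
    rw [Metric.tendsto_nhds]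
    intro ε hε
    obtain ⟨w, hw, hvw⟩ := hv (ε / (2 * (2 * |C| + 1))) (by positivity)
    have hw' : Tendsto (fun i => ∫ x, w x * k i x ∂ρ) l (𝓝 0) := hw
    filter_upwards [(Metric.tendsto_nhds.1 hw') (ε / 2) (by positivity)] with i hi
    rw [Real.dist_eq, sub_zero] at hi ⊢
    have hvi := L1.integrable_coeFn v
    have hwi := L1.integrable_coeFn w
    have h1 : ∫ x, v x * k i x ∂ρ = ∫ x, (v x - w x) * k i x ∂ρ + ∫ x, w x * k i x ∂ρ := by
      have h3 := integral_add (hint i (hvi.sub hwi)) (hint i hwi)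
      simp only [Pi.sub_apply] at h3
      rw [← h3]
      exact integral_congr_ae (Eventually.of_forall fun x => by ring)
    have h2 : |∫ x, (v x - w x) * k i x ∂ρ| ≤ ε / 2 := by
      calc |∫ x, (v x - w x) * k i x ∂ρ| ≤ ∫ x, |(v x - w x) * k i x| ∂ρ :=
            abs_integral_le_integral_abs
        _ ≤ ∫ x, |v x - w x| * (2 * |C|) ∂ρ := by
            refine integral_mono (hint i (hvi.sub hwi)).abs ((hvi.sub hwi).abs.mul_const _)
              fun x => ?_
            simp only [abs_mul]
            exact mul_le_mul_of_nonneg_left (hkC i x) (abs_nonneg _)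
        _ = ‖v - w‖ * (2 * |C|) := by
            rw [integral_mul_const, L1.norm_eq_integral_norm]
            congr 1
            refine integral_congr_ae ?_
            filter_upwards [Lp.coeFn_sub v w] with x hx
            rw [hx]
            rfl
        _ ≤ (ε / (2 * (2 * |C| + 1))) * (2 * |C| + 1) := by
            refine mul_le_mul ?_ (by linarith) (by positivity) (by positivity)
            rw [← dist_eq_norm]; exact hvw.le
        _ = ε / 2 := by field_simp
    rw [h1]
    exact (abs_add_le _ _).trans_lt (by linarith)
  · intro f₁ f₂ hae hf h1
    refine h1.congr fun i => integral_congr_ae ?_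
    filter_upwards [hae] with x hx
    rw [hx]

/-- A bounded family of functions which is asymptotically harmonic for a Harris recurrent kernel is
asymptotically constant, at every point. The function at `x` is compared with its mean under the law
of the chain at a late time, the singular part of which has small mass. -/
theorem tendsto_sub_integral_of_asymptotically_harmonic (hH : HarrisRecurrent g) {ρ : Measure S}
    [IsProbabilityMeasure ρ] (hρ : Kernel.Invariant g ρ) {h : ι → S → ℝ}
    (hm : ∀ i, Measurable (h i)) {C : ℝ} (hC : ∀ i x, |h i x| ≤ C)
    (hharm : ∀ x, Tendsto (fun i => h i x - ∫ y, h i y ∂(g x)) l (𝓝 0)) (x : S) :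
    Tendsto (fun i => h i x - ∫ y, h i y ∂ρ) l (𝓝 0) := by
  set k : ι → S → ℝ := fun i x => h i x - ∫ y, h i y ∂ρ with hk
  have hkm : ∀ i, Measurable (k i) := fun i => (hm i).sub_const _
  have hkC : ∀ i x, |k i x| ≤ 2 * |C| := fun i => abs_sub_integral_le_of_bdd (hC i)
  have hPm : ∀ i, Measurable fun z => ∫ y, h i y ∂(g z) := fun i =>
    ((hm i).stronglyMeasurable.integral_kernel (κ := g)).measurable
  have hPC : ∀ i z, |∫ y, h i y ∂(g z)| ≤ C := fun i z => abs_integral_le_of_bdd (hC i)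
  -- iterating the asymptotic harmonicity, at a fixed time
  have hstep : ∀ n, Tendsto (fun i => h i x - ∫ y, h i y ∂((g ^ n) x)) l (𝓝 0) := by
    intro n
    induction n with
    | zero =>
      refine tendsto_const_nhds.congr fun i => ?_
      rw [pow_zero]
      change _ = h i x - ∫ y, h i y ∂(Measure.dirac x)
      rw [integral_dirac' _ _ (hm i).stronglyMeasurable, sub_self]
    | succ n ih =>
      have h1 : Tendsto (fun i => ∫ z, (h i z - ∫ y, h i y ∂(g z)) ∂((g ^ n) x)) l (𝓝 0) := by
        have hz : (0 : ℝ) = ∫ z, (0 : ℝ) ∂((g ^ n) x) := by simp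
        rw [hz]
        refine tendsto_integral_filter_of_dominated_convergence (fun _ => 2 * C) ?_ ?_
          (integrable_const _) (Eventually.of_forall hharm)
        · exact Eventually.of_forall fun i => ((hm i).sub (hPm i)).aestronglyMeasurable
        · refine Eventually.of_forall fun i => Eventually.of_forall fun z => ?_
          calc |h i z - ∫ y, h i y ∂(g z)| ≤ |h i z| + |∫ y, h i y ∂(g z)| := abs_sub _ _
            _ ≤ 2 * C := by linarith [hC i z, hPC i z]
      have h2 := ih.add h1
      rw [add_zero] at h2
      refine h2.congr fun i => ?_
      rw [integral_sub (integrable_of_bdd (hm i) (hC i)) (integrable_of_bdd (hPm i) (hPC i)),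
        pow_succ']
      have : ∫ y, h i y ∂((g * g ^ n) x) = ∫ z, ∫ y, h i y ∂(g z) ∂((g ^ n) x) :=
        Kernel.integral_comp (η := g) (κ := g ^ n)
          (integrable_of_bdd (hm i) (hC i))
      rw [this]
      ring
  rw [Metric.tendsto_nhds]
  intro ε hε
  have hsing : Tendsto (fun n => (((g ^ n) x).singularPart ρ).real Set.univ) atTop (𝓝 0) := by
    have := (ENNReal.tendsto_toReal ENNReal.zero_ne_top).comp (tendsto_singularPart_pow hH hρ x)
    exact this
  obtain ⟨n, hn⟩ := ((Metric.tendsto_nhds.1 hsing) (ε / (4 * (2 * |C| + 1)))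
    (by positivity)).exists
  set u : S → ℝ := fun y => (((g ^ n) x).rnDeriv ρ y).toReal with hu
  have hui : Integrable u ρ := Measure.integrable_toReal_rnDeriv
  have hdec : ∀ i, h i x - ∫ y, h i y ∂ρ = (h i x - ∫ y, h i y ∂((g ^ n) x)) +
      ((∫ y, k i y ∂(((g ^ n) x).singularPart ρ)) + ∫ y, u y * k i y ∂ρ) := by
    intro i
    have hki : ∀ μ : Measure S, IsFiniteMeasure μ → Integrable (k i) μ := fun μ _ =>
      integrable_of_bdd (hkm i) (hkC i)
    have e1 : ∫ y, k i y ∂((g ^ n) x) = (∫ y, h i y ∂((g ^ n) x)) - ∫ y, h i y ∂ρ := by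
      rw [hk, integral_sub (integrable_of_bdd (hm i) (hC i)) (integrable_const _)]
      simp
    have e2 : ∫ y, k i y ∂((g ^ n) x) = (∫ y, k i y ∂(((g ^ n) x).singularPart ρ)) +
        ∫ y, u y * k i y ∂ρ := by
      conv_lhs => rw [((g ^ n) x).haveLebesgueDecomposition_add ρ]
      rw [integral_add_measure (hki _ inferInstance) (hki _ inferInstance)]
      congr 1
      rw [integral_withDensity_eq_integral_toReal_smul (Measure.measurable_rnDeriv _ _)
        (Measure.rnDeriv_lt_top _ _)]
      rfl
    rw [← e2, e1]
    ring
  have hw := tendsto_integral_mul_of_integrable hH hρ hm hC hharm hui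
  filter_upwards [(Metric.tendsto_nhds.1 hw) (ε / 4) (by positivity),
    (Metric.tendsto_nhds.1 (hstep n)) (ε / 4) (by positivity)] with i h1 h2
  rw [Real.dist_eq, sub_zero] at h1 h2 hn ⊢
  have h3 : |∫ y, k i y ∂(((g ^ n) x).singularPart ρ)| ≤ ε / 4 := by
    have := norm_integral_le_of_norm_le_const (μ := ((g ^ n) x).singularPart ρ) (f := k i)
      (Eventually.of_forall (hkC i))
    rw [Real.norm_eq_abs] at this
    refine this.trans ?_
    rw [abs_of_nonneg measureReal_nonneg] at hn
    calc 2 * |C| * (((g ^ n) x).singularPart ρ).real Set.univ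
        ≤ (2 * |C| + 1) * (ε / (4 * (2 * |C| + 1))) := by
          refine mul_le_mul (by linarith) hn.le measureReal_nonneg (by positivity)
      _ = ε / 4 := by field_simp
  rw [hdec i]
  calc _ ≤ |h i x - ∫ y, h i y ∂((g ^ n) x)| +
        (|∫ y, k i y ∂(((g ^ n) x).singularPart ρ)| + |∫ y, u y * k i y ∂ρ|) :=
        (abs_add_le _ _).trans (add_le_add le_rfl (abs_add_le _ _))
    _ < ε := by linarith

/-- Asymptotics of the solutions of the Markov renewal equation `R = 1_A + f · P R` as the
discount `f` tends to one. The rescaled solutions are asymptotically harmonic, hence asymptotically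
constant, and the constant is found by integrating the equation against `ρ`. -/
theorem tendsto_mul_of_renewal_equation (hH : HarrisRecurrent g) {ρ : Measure S}
    [IsProbabilityMeasure ρ] (hρ : Kernel.Invariant g ρ) {A : Set S} (hA : MeasurableSet A)
    {f R : ι → S → ℝ} {ψ : ι → ℝ} (hψ : ∀ᶠ i in l, 0 < ψ i) (hψ0 : Tendsto ψ l (𝓝 0))
    (hRm : ∀ i, Measurable (R i)) (hfm : ∀ i, Measurable (f i)) {C : ℝ}
    (hRC : ∀ᶠ i in l, ∀ x, |ψ i * R i x| ≤ C)
    (hR : ∀ᶠ i in l, ∀ x, R i x = A.indicator 1 x + f i x * ∫ y, R i y ∂(g x))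
    (hf1 : ∀ x, Tendsto (fun i => f i x) l (𝓝 1))
    {w W : S → ℝ} (hW : Integrable W ρ)
    (hbd : ∀ᶠ i in l, ∀ᵐ x ∂ρ, |(1 - f i x) / ψ i| ≤ W x)
    (hw : ∀ᵐ x ∂ρ, Tendsto (fun i => (1 - f i x) / ψ i) l (𝓝 (w x)))
    (hw0 : ∫ x, w x ∂ρ ≠ 0) (x : S) :
    Tendsto (fun i => ψ i * R i x) l (𝓝 (ρ.real A / ∫ x, w x ∂ρ)) := by
  classical
  -- indices at which the bounds fail are discarded by truncating the family
  set G : ι → Prop := fun i => ∀ x, |ψ i * R i x| ≤ C with hG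
  set h : ι → S → ℝ := fun i x => if G i then ψ i * R i x else 0 with hh
  by_cases hl : l = ⊥
  · simp [hl]
  have hl' : l.NeBot := ⟨hl⟩
  have hC0 : 0 ≤ C := by
    obtain ⟨i, hi⟩ := hRC.exists
    exact (abs_nonneg _).trans (hi x)
  have hhm : ∀ i, Measurable (h i) := fun i => by
    by_cases hi : G i
    · simp only [hh, hi, if_true]; exact (hRm i).const_mul _
    · simp only [hh, hi, if_false]; exact measurable_const
  have hhC : ∀ i x, |h i x| ≤ C := fun i x => by
    by_cases hi : G i
    · simp only [hh, hi, if_true]; exact hi x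
    · simp only [hh, hi, if_false]; simpa using hC0
  have hPC : ∀ i z, |∫ y, h i y ∂(g z)| ≤ C := fun i z => abs_integral_le_of_bdd (hhC i)
  have hPm : ∀ i, Measurable fun z => ∫ y, h i y ∂(g z) := fun i =>
    ((hhm i).stronglyMeasurable.integral_kernel (κ := g)).measurable
  have heq : ∀ᶠ i in l, ∀ x, h i x = ψ i * A.indicator 1 x + f i x * ∫ y, h i y ∂(g x) := by
    filter_upwards [hRC, hR] with i h1 h2 x
    have hi : G i := h1
    simp only [hh, hi, if_true]
    rw [integral_const_mul, h2 x]
    ring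
  have hharm : ∀ x, Tendsto (fun i => h i x - ∫ y, h i y ∂(g x)) l (𝓝 0) := by
    intro x
    have h1 : Tendsto (fun i => ψ i * A.indicator 1 x) l (𝓝 0) := by
      simpa using hψ0.mul_const (A.indicator (1 : S → ℝ) x)
    have h2 : Tendsto (fun i => (f i x - 1) * ∫ y, h i y ∂(g x)) l (𝓝 0) := by
      have h3 : Tendsto (fun i => f i x - 1) l (𝓝 0) := by simpa using (hf1 x).sub_const 1
      exact h3.zero_mul_isBoundedUnder_le
        (isBoundedUnder_of ⟨C, fun i => by simpa using hPC i x⟩)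
    have h4 := h1.add h2
    rw [add_zero] at h4
    refine h4.congr' ?_
    filter_upwards [heq] with i hi
    rw [hi x]
    ring
  have hconst := tendsto_sub_integral_of_asymptotically_harmonic hH hρ hhm hhC hharm
  have hPconst : ∀ x, Tendsto (fun i => (∫ y, h i y ∂(g x)) - ∫ y, h i y ∂ρ) l (𝓝 0) := by
    intro x
    have := (hconst x).sub (hharm x)
    rw [sub_zero] at this
    exact this.congr fun i => by ring
  have hqm : ∀ i, Measurable fun x => (1 - f i x) / ψ i := fun i =>
    (measurable_const.sub (hfm i)).div_const _
  have hqi : ∀ᶠ i in l, Integrable (fun x => (1 - f i x) / ψ i) ρ := by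
    filter_upwards [hbd] with i hi
    exact hW.mono' (hqm i).aestronglyMeasurable hi
  have hwlim : Tendsto (fun i => ∫ x, (1 - f i x) / ψ i ∂ρ) l (𝓝 (∫ x, w x ∂ρ)) :=
    tendsto_integral_filter_of_dominated_convergence W
      (Eventually.of_forall fun i => (hqm i).aestronglyMeasurable) hbd hW hw
  have herr : Tendsto (fun i => ∫ x, (1 - f i x) / ψ i *
      ((∫ y, h i y ∂(g x)) - ∫ y, h i y ∂ρ) ∂ρ) l (𝓝 0) := by
    have hz : (0 : ℝ) = ∫ x, (0 : ℝ) ∂ρ := by simp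
    rw [hz]
    refine tendsto_integral_filter_of_dominated_convergence (fun x => W x * (2 * C)) ?_ ?_
      (hW.mul_const _) ?_
    · exact Eventually.of_forall fun i =>
        ((hqm i).mul ((hPm i).sub_const _)).aestronglyMeasurable
    · filter_upwards [hbd] with i hi
      filter_upwards [hi] with x hx
      rw [norm_mul, Real.norm_eq_abs, Real.norm_eq_abs]
      refine mul_le_mul hx ?_ (abs_nonneg _) ((abs_nonneg _).trans hx)
      calc _ ≤ |∫ y, h i y ∂(g x)| + |∫ y, h i y ∂ρ| := abs_sub _ _
        _ ≤ 2 * C := by linarith [hPC i x, abs_integral_le_of_bdd (μ := ρ) (hhC i)]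
    · filter_upwards [hw] with x hx
      have := hx.mul (hPconst x)
      rwa [mul_zero] at this
  -- the renewal equation integrated against `ρ`, where the two integrals of `h` cancel
  have hmass : ∀ᶠ i in l, (∫ y, h i y ∂ρ) * ∫ x, (1 - f i x) / ψ i ∂ρ =
      ρ.real A - ∫ x, (1 - f i x) / ψ i * ((∫ y, h i y ∂(g x)) - ∫ y, h i y ∂ρ) ∂ρ := by
    filter_upwards [hqi, heq, hψ] with i hi he hp
    have e1 : ∫ x, (h i x - ∫ y, h i y ∂(g x)) ∂ρ = 0 := by
      rw [integral_sub (integrable_of_bdd (hhm i) (hhC i)) (integrable_of_bdd (hPm i) (hPC i)),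
        integral_invariant hρ (hhm i) (hhC i), sub_self]
    have e2 : Integrable (fun x => (1 - f i x) / ψ i * ∫ y, h i y ∂(g x)) ρ :=
      hi.mul_bdd (c := C) (hPm i).aestronglyMeasurable (Eventually.of_forall (hPC i))
    have e3 : ∫ x, (1 - f i x) / ψ i * ∫ y, h i y ∂(g x) ∂ρ = ρ.real A := by
      have e4 : ∀ x, h i x - ∫ y, h i y ∂(g x) = ψ i * (A.indicator 1 x -
          (1 - f i x) / ψ i * ∫ y, h i y ∂(g x)) := fun x => by
        have := he x
        rw [mul_sub, ← mul_assoc, mul_div_cancel₀ _ hp.ne']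
        linarith
      simp_rw [e4] at e1
      have e5 : Integrable (A.indicator (1 : S → ℝ)) ρ :=
        (integrable_const (1 : ℝ)).indicator hA
      rw [integral_const_mul, integral_sub e5 e2, integral_indicator_one hA] at e1
      have := (mul_eq_zero.1 e1).resolve_left hp.ne'
      linarith
    simp_rw [mul_sub]
    rw [integral_sub e2 (hi.mul_const _), e3, integral_mul_const]
    ring
  have hmean : Tendsto (fun i => ∫ y, h i y ∂ρ) l (𝓝 (ρ.real A / ∫ x, w x ∂ρ)) := by
    have h1 := ((tendsto_const_nhds (x := ρ.real A)).sub herr).div hwlim hw0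
    rw [sub_zero] at h1
    refine h1.congr' ?_
    filter_upwards [hmass, hwlim.eventually_ne hw0] with i h2 h3
    simp only [Pi.div_apply]
    rw [← h2, mul_div_cancel_right₀ _ h3]
  have hfin := (hconst x).add hmean
  rw [zero_add] at hfin
  refine hfin.congr' ?_
  filter_upwards [hRC] with i hi
  have hi' : G i := hi
  simp [hh, hi']

end Ergodic

/-! ### A Tauberian theorem for nondecreasing functions -/

section Tauberian

variable {ι : Type*} {l : Filter ι}

theorem integrableOn_exp_mul_comp {f : ℝ → ℝ}
    (hf : IntegrableOn (fun x => Real.exp (-x) * f x) (Set.Ioi 0)) {G : ℝ → ℝ}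
    (hG : Continuous G) :
    IntegrableOn (fun x => Real.exp (-x) * f x * G (Real.exp (-x))) (Set.Ioi 0) := by
  obtain ⟨M, hM⟩ := (isCompact_Icc (a := (0 : ℝ)) (b := 1)).exists_bound_of_continuousOn
    hG.continuousOn
  refine Integrable.mul_bdd (c := M) hf (by fun_prop) ?_
  refine (ae_restrict_mem measurableSet_Ioi).mono fun x hx => hM _ ⟨(Real.exp_pos _).le, ?_⟩
  rw [Real.exp_le_one_iff]
  have : (0 : ℝ) < x := hx
  linarith

/-- Convergence of the Laplace transforms at the positive integers extends, by the Weierstrass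
approximation theorem, to all test functions that are continuous in `exp (-x)`. -/
theorem tendsto_integral_exp_mul_comp {f : ι → ℝ → ℝ} {γ : ℝ → ℝ}
    (hf0 : ∀ i, ∀ x, 0 < x → 0 ≤ f i x) (hγ0 : ∀ x, 0 < x → 0 ≤ γ x)
    (hfi : ∀ i, IntegrableOn (fun x => Real.exp (-x) * f i x) (Set.Ioi 0))
    (hγi : IntegrableOn (fun x => Real.exp (-x) * γ x) (Set.Ioi 0))
    (hlim : ∀ k : ℕ, 1 ≤ k → Tendsto (fun i => ∫ x in Set.Ioi 0, Real.exp (-(k * x)) * f i x) l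
      (𝓝 (∫ x in Set.Ioi 0, Real.exp (-(k * x)) * γ x)))
    {G : ℝ → ℝ} (hG : Continuous G) :
    Tendsto (fun i => ∫ x in Set.Ioi 0, Real.exp (-x) * f i x * G (Real.exp (-x))) l
      (𝓝 (∫ x in Set.Ioi 0, Real.exp (-x) * γ x * G (Real.exp (-x)))) := by
  have hpoly : ∀ p : Polynomial ℝ,
      Tendsto (fun i => ∫ x in Set.Ioi 0, Real.exp (-x) * f i x * p.eval (Real.exp (-x))) l
        (𝓝 (∫ x in Set.Ioi 0, Real.exp (-x) * γ x * p.eval (Real.exp (-x)))) := by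
    intro p
    induction p using Polynomial.induction_on' with
    | add p q hp hq =>
      have e : ∀ h : ℝ → ℝ, IntegrableOn (fun x => Real.exp (-x) * h x) (Set.Ioi 0) →
          ∫ x in Set.Ioi 0, Real.exp (-x) * h x * (p + q).eval (Real.exp (-x)) =
          (∫ x in Set.Ioi 0, Real.exp (-x) * h x * p.eval (Real.exp (-x))) +
            ∫ x in Set.Ioi 0, Real.exp (-x) * h x * q.eval (Real.exp (-x)) := by
        intro h hh
        rw [← integral_add (integrableOn_exp_mul_comp hh p.continuous)
          (integrableOn_exp_mul_comp hh q.continuous)]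
        simp only [Polynomial.eval_add, mul_add]
      rw [e γ hγi]
      exact (hp.add hq).congr fun i => (e (f i) (hfi i)).symm
    | monomial n c =>
      have e : ∀ h : ℝ → ℝ,
          ∫ x in Set.Ioi 0, Real.exp (-x) * h x * (Polynomial.monomial n c).eval (Real.exp (-x)) =
          c * ∫ x in Set.Ioi 0, Real.exp (-((n + 1 : ℕ) * x)) * h x := by
        intro h
        rw [← integral_const_mul]
        congr 1
        ext x
        rw [Polynomial.eval_monomial]
        have : Real.exp (-((n + 1 : ℕ) * x)) = Real.exp (-x) * Real.exp (-x) ^ n := by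
          rw [← pow_succ', ← Real.exp_nat_mul]
          congr 1
          ring
        rw [this]
        ring
      rw [e γ]
      exact ((hlim (n + 1) (by omega)).const_mul c).congr fun i => (e (f i)).symm
  rw [Metric.tendsto_nhds]
  intro ε hε
  set M : ℝ := ∫ x in Set.Ioi 0, Real.exp (-x) * γ x with hM
  have hM0 : 0 ≤ M := setIntegral_nonneg measurableSet_Ioi fun x hx =>
    mul_nonneg (Real.exp_pos _).le (hγ0 x hx)
  obtain ⟨p, hp⟩ := exists_polynomial_near_of_continuousOn 0 1 G hG.continuousOn
    (ε / (3 * (M + 1))) (by positivity)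
  have happrox : ∀ h : ℝ → ℝ, (∀ x, 0 < x → 0 ≤ h x) →
      IntegrableOn (fun x => Real.exp (-x) * h x) (Set.Ioi 0) →
      |(∫ x in Set.Ioi 0, Real.exp (-x) * h x * G (Real.exp (-x))) -
        ∫ x in Set.Ioi 0, Real.exp (-x) * h x * p.eval (Real.exp (-x))| ≤
        (∫ x in Set.Ioi 0, Real.exp (-x) * h x) * (ε / (3 * (M + 1))) := by
    intro h h0 hh
    rw [← integral_sub (integrableOn_exp_mul_comp hh hG)
      (integrableOn_exp_mul_comp hh p.continuous), ← integral_mul_const]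
    refine abs_integral_le_integral_abs.trans ?_
    refine setIntegral_mono_on ((integrableOn_exp_mul_comp hh hG).sub
      (integrableOn_exp_mul_comp hh p.continuous)).abs (hh.mul_const _) measurableSet_Ioi
      fun x hx => ?_
    have hx' : (0 : ℝ) < x := hx
    rw [← mul_sub, abs_mul,
      abs_of_nonneg (mul_nonneg (Real.exp_pos _).le (h0 x hx))]
    refine mul_le_mul_of_nonneg_left ?_ (mul_nonneg (Real.exp_pos _).le (h0 x hx))
    rw [abs_sub_comm]
    refine (hp _ ⟨(Real.exp_pos _).le, ?_⟩).le
    rw [Real.exp_le_one_iff]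
    linarith
  have h1 := hlim 1 le_rfl
  simp only [Nat.cast_one, one_mul] at h1
  filter_upwards [(Metric.tendsto_nhds.1 (hpoly p)) (ε / 3) (by positivity),
    h1.eventually (gt_mem_nhds (lt_add_one M))] with i h2 h3
  have h4 := happrox (f i) (hf0 i) (hfi i)
  have h5 := happrox γ hγ0 hγi
  have h6 : (∫ x in Set.Ioi 0, Real.exp (-x) * f i x) * (ε / (3 * (M + 1))) < ε / 3 := by
    calc _ < (M + 1) * (ε / (3 * (M + 1))) := by gcongr
      _ = ε / 3 := by field_simp
  have h7 : M * (ε / (3 * (M + 1))) ≤ ε / 3 := by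
    calc _ ≤ (M + 1) * (ε / (3 * (M + 1))) := by gcongr; linarith
      _ = ε / 3 := by field_simp
  rw [Real.dist_eq, abs_lt] at h2 ⊢
  rw [abs_le] at h4 h5
  constructor <;> linarith [h4.1, h4.2, h5.1, h5.2, h2.1, h2.2]

/-- A continuity theorem for Laplace transforms of nondecreasing functions: convergence of the
transforms at the positive integers yields convergence of the functions at a continuity point of
the limit, here `1`. -/
theorem tendsto_apply_one_of_laplace {f : ι → ℝ → ℝ} {γ : ℝ → ℝ}
    (hf0 : ∀ i, ∀ x, 0 < x → 0 ≤ f i x) (hγ0 : ∀ x, 0 < x → 0 ≤ γ x)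
    (hfm : ∀ i, MonotoneOn (f i) (Set.Ioi 0)) (hγm : MonotoneOn γ (Set.Ioi 0))
    (hγc : ContinuousAt γ 1)
    (hfi : ∀ i, IntegrableOn (fun x => Real.exp (-x) * f i x) (Set.Ioi 0))
    (hγi : IntegrableOn (fun x => Real.exp (-x) * γ x) (Set.Ioi 0))
    (hlim : ∀ k : ℕ, 1 ≤ k → Tendsto (fun i => ∫ x in Set.Ioi 0, Real.exp (-(k * x)) * f i x) l
      (𝓝 (∫ x in Set.Ioi 0, Real.exp (-(k * x)) * γ x))) :
    Tendsto (fun i => f i 1) l (𝓝 (γ 1)) := by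
  -- a bump, continuous in `exp (-x)`, supported in `[u, v]`
  set B : ℝ → ℝ → ℝ → ℝ := fun u v y => max 0 ((y - Real.exp (-v)) * (Real.exp (-u) - y)) with hB
  have hBc : ∀ u v, Continuous (B u v) := fun u v => by
    simp only [hB]; fun_prop
  have hB0 : ∀ u v y, 0 ≤ B u v y := fun u v y => le_max_left _ _
  have hBs : ∀ u v x, B u v (Real.exp (-x)) ≠ 0 → u ≤ v → u < x ∧ x < v := by
    intro u v x h huv
    have h1 : 0 < (Real.exp (-x) - Real.exp (-v)) * (Real.exp (-u) - Real.exp (-x)) := by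
      by_contra h2
      exact h (max_eq_left (not_lt.1 h2))
    have h3 : Real.exp (-v) ≤ Real.exp (-u) := Real.exp_le_exp.2 (by linarith)
    rcases pos_and_pos_or_neg_and_neg_of_mul_pos h1 with ⟨h4, h5⟩ | ⟨h4, h5⟩
    · rw [sub_pos, Real.exp_lt_exp] at h4 h5
      constructor <;> linarith
    · linarith
  have he1 : IntegrableOn (fun x : ℝ => Real.exp (-x) * 1) (Set.Ioi 0) := by
    simpa using integrableOn_exp_neg_Ioi 0
  have hBi : ∀ u v, IntegrableOn (fun x => Real.exp (-x) * 1 * B u v (Real.exp (-x)))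
      (Set.Ioi 0) := fun u v => integrableOn_exp_mul_comp (f := fun _ => 1) he1 (hBc u v)
  have hBpos : ∀ u v, 0 ≤ u → u < v →
      0 < ∫ x in Set.Ioi 0, Real.exp (-x) * 1 * B u v (Real.exp (-x)) := by
    intro u v hu huv
    rw [setIntegral_pos_iff_support_of_nonneg_ae _ (hBi u v)]
    · refine lt_of_lt_of_le ?_ (measure_mono (s := Set.Ioo u v) fun x hx => ⟨?_, ?_⟩)
      · simp [huv]
      · have h1 : 0 < (Real.exp (-x) - Real.exp (-v)) * (Real.exp (-u) - Real.exp (-x)) := by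
          apply mul_pos <;> rw [sub_pos, Real.exp_lt_exp] <;> linarith [hx.1, hx.2]
        have h2 : 0 < B u v (Real.exp (-x)) := lt_max_of_lt_right h1
        have := Real.exp_pos (-x)
        exact (by positivity : 0 < Real.exp (-x) * 1 * B u v (Real.exp (-x))).ne'
      · exact hu.trans_lt hx.1
    · exact Eventually.of_forall fun x => mul_nonneg (by positivity) (hB0 _ _ _)
  -- the mean of a nondecreasing function under the bump lies between its values at `u` and `v`
  have hup : ∀ (h : ℝ → ℝ) (u v : ℝ), MonotoneOn h (Set.Ioi 0) →
      IntegrableOn (fun x => Real.exp (-x) * h x) (Set.Ioi 0) → 0 < v → u ≤ v →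
      ∫ x in Set.Ioi 0, Real.exp (-x) * h x * B u v (Real.exp (-x)) ≤
        h v * ∫ x in Set.Ioi 0, Real.exp (-x) * 1 * B u v (Real.exp (-x)) := by
    intro h u v hm hi hv huv
    rw [← integral_const_mul]
    refine setIntegral_mono_on (integrableOn_exp_mul_comp hi (hBc u v)) ((hBi u v).const_mul _)
      measurableSet_Ioi fun x hx => ?_
    by_cases hz : B u v (Real.exp (-x)) = 0
    · simp [hz]
    · have := hm hx hv (hBs u v x hz huv).2.le
      have h1 := mul_le_mul_of_nonneg_right this
        (mul_nonneg (Real.exp_pos (-x)).le (hB0 u v (Real.exp (-x))))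
      linarith
  have hdown : ∀ (h : ℝ → ℝ) (u v : ℝ), MonotoneOn h (Set.Ioi 0) →
      IntegrableOn (fun x => Real.exp (-x) * h x) (Set.Ioi 0) → 0 < u → u ≤ v →
      h u * (∫ x in Set.Ioi 0, Real.exp (-x) * 1 * B u v (Real.exp (-x))) ≤
        ∫ x in Set.Ioi 0, Real.exp (-x) * h x * B u v (Real.exp (-x)) := by
    intro h u v hm hi hu huv
    rw [← integral_const_mul]
    refine setIntegral_mono_on ((hBi u v).const_mul _) (integrableOn_exp_mul_comp hi (hBc u v))
      measurableSet_Ioi fun x hx => ?_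
    by_cases hz : B u v (Real.exp (-x)) = 0
    · simp [hz]
    · have := hm hu hx (hBs u v x hz huv).1.le
      have h1 := mul_le_mul_of_nonneg_right this
        (mul_nonneg (Real.exp_pos (-x)).le (hB0 u v (Real.exp (-x))))
      linarith
  have hconv := fun u v => tendsto_integral_exp_mul_comp hf0 hγ0 hfi hγi hlim (hBc u v)
  rw [tendsto_order]
  have hcont := Metric.continuousAt_iff.1 hγc
  constructor
  · intro c hc
    obtain ⟨δ, hδ, hd⟩ := hcont (γ 1 - c) (by linarith)
    set u := max (1 / 2) (1 - δ / 2) with hu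
    have hu1 : u < 1 := max_lt (by norm_num) (by linarith)
    have hu0 : 0 < u := lt_max_of_lt_left (by norm_num)
    have hγu : c < γ u := by
      have := hd (x := u) (by
        rw [Real.dist_eq, abs_lt]
        constructor <;> linarith [le_max_right (1 / 2 : ℝ) (1 - δ / 2)])
      rw [Real.dist_eq, abs_lt] at this
      linarith [this.1]
    have hm := hBpos u 1 hu0.le hu1
    have h1 := hdown γ u 1 hγm hγi hu0 hu1.le
    have h2 : c * (∫ x in Set.Ioi 0, Real.exp (-x) * 1 * B u 1 (Real.exp (-x))) <
        ∫ x in Set.Ioi 0, Real.exp (-x) * γ x * B u 1 (Real.exp (-x)) :=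
      (mul_lt_mul_of_pos_right hγu hm).trans_le h1
    filter_upwards [(hconv u 1).eventually (lt_mem_nhds h2)] with i hi
    exact lt_of_mul_lt_mul_right (hi.trans_le (hup (f i) u 1 (hfm i) (hfi i) one_pos hu1.le)) hm.le
  · intro c hc
    obtain ⟨δ, hδ, hd⟩ := hcont (c - γ 1) (by linarith)
    set v := 1 + δ / 2 with hv
    have hv1 : 1 < v := by linarith
    have hγv : γ v < c := by
      have := hd (x := v) (by rw [Real.dist_eq, abs_lt]; constructor <;> linarith)
      rw [Real.dist_eq, abs_lt] at this
      linarith [this.2]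
    have hm := hBpos 1 v zero_le_one hv1
    have h1 := hup γ 1 v hγm hγi (by linarith) hv1.le
    have h2 : ∫ x in Set.Ioi 0, Real.exp (-x) * γ x * B 1 v (Real.exp (-x)) <
        c * (∫ x in Set.Ioi 0, Real.exp (-x) * 1 * B 1 v (Real.exp (-x))) :=
      h1.trans_lt (mul_lt_mul_of_pos_right hγv hm)
    filter_upwards [(hconv 1 v).eventually (gt_mem_nhds h2)] with i hi
    exact lt_of_mul_lt_mul_right
      ((hdown (f i) 1 v (hfm i) (hfi i) one_pos hv1.le).trans_lt hi) hm.le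

/-- Karamata's Tauberian theorem, with the regular variation of the transform expressed through a
normalizing function `ψ`: a nondecreasing function `U` for which
`ψ s · s · ∫ exp (-s t) U(t) dt → D` as `s → 0` and `ψ (c / T) / ψ (1 / T) → c ^ r` satisfies
`ψ (1 / T) · U(T) → D / Γ(1 + r)`. -/
theorem tendsto_of_laplace_regularlyVarying {U ψ : ℝ → ℝ} {r D : ℝ} (hr : 0 ≤ r) (hD : 0 ≤ D)
    (hU0 : ∀ t, 0 ≤ U t) (hUm : Monotone U) (hψ : ∀ s, 0 < s → 0 < ψ s)
    (hUi : ∀ s, 0 < s → IntegrableOn (fun t => Real.exp (-(s * t)) * U t) (Set.Ioi 0))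
    (hlap : Tendsto (fun s => ψ s * (s * ∫ t in Set.Ioi 0, Real.exp (-(s * t)) * U t))
      (𝓝[>] 0) (𝓝 D))
    (hreg : ∀ c : ℝ, 0 < c → Tendsto (fun T => ψ (c / T) / ψ (1 / T)) atTop (𝓝 (c ^ r))) :
    Tendsto (fun T => ψ (1 / T) * U T) atTop (𝓝 (D / Real.Gamma (1 + r))) := by
  have hscale : ∀ T : ℝ, 0 < T → ∀ k : ℝ,
      ∫ x in Set.Ioi 0, Real.exp (-(k * x)) * U (T * x) =
        T⁻¹ * ∫ t in Set.Ioi 0, Real.exp (-(k / T * t)) * U t := by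
    intro T hT k
    have := integral_comp_mul_left_Ioi (fun t => Real.exp (-(k / T * t)) * U t) 0 hT
    rw [mul_zero, smul_eq_mul] at this
    rw [← this]
    congr 1
    ext x
    congr 3
    field_simp
  have hΓ : 0 < Real.Gamma (1 + r) := Real.Gamma_pos_of_pos (by linarith)
  have hgam : ∀ k : ℝ, 0 < k → ∫ x in Set.Ioi 0, Real.exp (-(k * x)) *
      (D / Real.Gamma (1 + r) * x ^ r) = D * k ^ (-(r + 1)) := by
    intro k hk
    have h1 := Real.integral_rpow_mul_exp_neg_mul_Ioi (a := r + 1) (r := k) (by linarith) hk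
    have h2 : ∀ x : ℝ, Real.exp (-(k * x)) * (D / Real.Gamma (1 + r) * x ^ r) =
      D / Real.Gamma (1 + r) * (x ^ (r + 1 - 1) * Real.exp (-(k * x))) := fun x => by
        rw [add_sub_cancel_right]; ring
    simp_rw [h2]
    rw [integral_const_mul, h1, add_comm 1 r, one_div, Real.inv_rpow hk.le, Real.rpow_neg hk.le]
    rw [add_comm 1 r] at hΓ
    field_simp
  -- the cut-off at `T = 1` only serves to keep the scale positive for every `T`
  set F : ℝ → ℝ → ℝ := fun T x => ψ (1 / max T 1) * U (max T 1 * x) with hF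
  have hT1 : ∀ T : ℝ, 0 < max T 1 := fun T => lt_max_of_lt_right one_pos
  have hψ1 : ∀ T, 0 < ψ (1 / max T 1) := fun T => hψ _ (by have := hT1 T; positivity)
  have hFi : ∀ T, IntegrableOn (fun x => Real.exp (-x) * F T x) (Set.Ioi 0) := by
    intro T
    have h0 := hT1 T
    have h1 := (integrableOn_Ioi_comp_mul_left_iff
      (fun t => Real.exp (-(1 / max T 1 * t)) * U t) 0 h0).2
      (by rw [mul_zero]; exact hUi _ (by positivity))
    refine (h1.const_mul (ψ (1 / max T 1))).congr (Eventually.of_forall fun x => ?_)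
    simp only [hF]
    rw [← mul_assoc (1 / max T 1), one_div_mul_cancel h0.ne', one_mul]
    ring
  have key := tendsto_apply_one_of_laplace (l := atTop) (f := F)
    (γ := fun x => D / Real.Gamma (1 + r) * x ^ r)
    (fun T x _ => mul_nonneg (hψ1 T).le (hU0 _))
    (fun x hx => by positivity)
    (fun T x _ y _ hxy => mul_le_mul_of_nonneg_left
      (hUm (mul_le_mul_of_nonneg_left hxy (hT1 T).le)) (hψ1 T).le)
    (fun x hx y _ hxy => mul_le_mul_of_nonneg_left
      (Real.rpow_le_rpow (le_of_lt hx) hxy hr) (by positivity))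
    (continuousAt_const.mul (Real.continuousAt_rpow_const _ _ (Or.inl one_ne_zero)))
    hFi ?_ ?_
  · simp only [Real.one_rpow, mul_one] at key
    refine key.congr' ?_
    filter_upwards [eventually_ge_atTop 1] with T hT
    simp only [hF, max_eq_left hT, mul_one]
  · have h1 := Real.GammaIntegral_convergent (s := r + 1) (by linarith)
    refine (h1.const_mul (D / Real.Gamma (1 + r))).congr (Eventually.of_forall fun x => ?_)
    simp only [add_sub_cancel_right]
    ring
  · intro k hk
    have hk0 : (0 : ℝ) < k := by exact_mod_cast hk
    rw [hgam k hk0]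
    have h1 : Tendsto (fun T : ℝ => (k : ℝ) / T) atTop (𝓝[>] 0) := by
      refine tendsto_nhdsWithin_iff.2 ⟨tendsto_const_nhds.div_atTop tendsto_id, ?_⟩
      filter_upwards [eventually_gt_atTop 0] with T hT
      exact div_pos hk0 hT
    have h2 := ((hlap.comp h1).div (hreg k hk0) (by positivity)).const_mul (k : ℝ)⁻¹
    have h3 : (k : ℝ)⁻¹ * (D / (k : ℝ) ^ r) = D * (k : ℝ) ^ (-(r + 1)) := by
      rw [Real.rpow_neg hk0.le, Real.rpow_add hk0, Real.rpow_one]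
      field_simp
    rw [← h3]
    refine h2.congr' ?_
    filter_upwards [eventually_ge_atTop 1] with T hT
    have hT0 : 0 < T := by linarith
    have e : ∀ x, Real.exp (-(k * x)) * F T x =
        ψ (1 / T) * (Real.exp (-(k * x)) * U (T * x)) := fun x => by
      simp only [hF, max_eq_left hT]; ring
    simp_rw [e]
    rw [integral_const_mul, hscale T hT0 k]
    simp only [Pi.div_apply, Function.comp]
    have := hψ (1 / T) (by positivity)
    have := hψ (k / T) (by positivity)
    field_simp

end Tauberian

/-! ### The Laplace transform of the Markov renewal measure -/

section Laplace

/-- The Laplace transform `∫ exp (-s x) dμ(x)` of a measure on the line. -/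
noncomputable def laplace (μ : Measure ℝ) (s : ℝ) : ℝ := ∫ x, Real.exp (-(s * x)) ∂μ

variable {μ : Measure ℝ}

theorem ae_nonneg_of_measure_Iio (h0 : μ (Set.Iio 0) = 0) : ∀ᵐ x ∂μ, 0 ≤ x := by
  simpa [ae_iff, Set.Iio] using h0

theorem ae_exp_le_one (h0 : μ (Set.Iio 0) = 0) {s : ℝ} (hs : 0 ≤ s) :
    ∀ᵐ x ∂μ, ‖Real.exp (-(s * x))‖ ≤ 1 := by
  filter_upwards [ae_nonneg_of_measure_Iio h0] with x hx
  rw [Real.norm_eq_abs, Real.abs_exp, Real.exp_le_one_iff]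
  have := mul_nonneg hs hx
  linarith

theorem laplace_nonneg (s : ℝ) : 0 ≤ laplace μ s :=
  integral_nonneg fun _ => (Real.exp_pos _).le

variable [IsProbabilityMeasure μ]

theorem integrable_exp_neg (h0 : μ (Set.Iio 0) = 0) {s : ℝ} (hs : 0 ≤ s) :
    Integrable (fun x => Real.exp (-(s * x))) μ :=
  Integrable.of_bound (by fun_prop) 1 (ae_exp_le_one h0 hs)

theorem laplace_le_one (h0 : μ (Set.Iio 0) = 0) {s : ℝ} (hs : 0 ≤ s) : laplace μ s ≤ 1 := by
  have := norm_integral_le_of_norm_le_const (ae_exp_le_one h0 hs)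
  rw [probReal_univ, mul_one] at this
  exact (le_abs_self _).trans this

theorem lintegral_exp_eq_laplace (h0 : μ (Set.Iio 0) = 0) {s : ℝ} (hs : 0 ≤ s) :
    ∫⁻ x, ENNReal.ofReal (Real.exp (-(s * x))) ∂μ = ENNReal.ofReal (laplace μ s) :=
  (ofReal_integral_eq_lintegral_ofReal (integrable_exp_neg h0 hs)
    (Eventually.of_forall fun _ => (Real.exp_pos _).le)).symm

theorem tendsto_laplace_zero (h0 : μ (Set.Iio 0) = 0) :
    Tendsto (laplace μ) (𝓝[>] 0) (𝓝 1) := by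
  have h1 : (1 : ℝ) = ∫ x, (1 : ℝ) ∂μ := by simp
  rw [h1]
  refine tendsto_integral_filter_of_dominated_convergence (fun _ => 1) ?_ ?_ (integrable_const _) ?_
  · exact Eventually.of_forall fun s => by fun_prop
  · filter_upwards [self_mem_nhdsWithin] with s hs
    exact ae_exp_le_one h0 (le_of_lt hs)
  · refine Eventually.of_forall fun x => ?_
    have : Continuous fun s : ℝ => Real.exp (-(s * x)) := by fun_prop
    simpa using (this.tendsto 0).mono_left nhdsWithin_le_nhds

theorem lintegral_exp_mul_indicator_Ici {s S : ℝ} (hs : 0 < s) (hS : 0 ≤ S) :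
    ∫⁻ t in Set.Ioi 0, ENNReal.ofReal (s * Real.exp (-(s * t))) * (Set.Ici S).indicator 1 t =
      ENNReal.ofReal (Real.exp (-(s * S))) := by
  have h1 : ∀ t : ℝ, ENNReal.ofReal (s * Real.exp (-(s * t))) * (Set.Ici S).indicator 1 t =
      (Set.Ici S).indicator (fun t => ENNReal.ofReal (s * Real.exp (-(s * t)))) t := fun t => by
    by_cases ht : t ∈ Set.Ici S <;> simp [ht]
  have hIci : ∀ c : ℝ, volume.restrict (Set.Ici c) = volume.restrict (Set.Ioi c) := fun c =>
    Measure.restrict_congr_set Ioi_ae_eq_Ici.symm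
  simp_rw [h1]
  rw [← hIci, lintegral_indicator measurableSet_Ici,
    Measure.restrict_restrict measurableSet_Ici,
    Set.inter_eq_left.2 (Set.Ici_subset_Ici.2 hS), hIci,
    ← ofReal_integral_eq_lintegral_ofReal]
  · rw [integral_const_mul]
    have := integral_exp_mul_Ioi (neg_lt_zero.2 hs) S
    simp only [neg_mul] at this
    rw [this]
    congr 1
    field_simp
  · have := integrableOn_exp_mul_Ioi (neg_lt_zero.2 hs) S
    simp only [neg_mul] at this
    exact this.const_mul s
  · exact Eventually.of_forall fun t => by positivity

end Laplace

section Renewal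

variable {S : Type*} [MeasurableSpace S] (g : Kernel S S)

/-- The discounted transition operator `f ↦ φ · P f` on nonnegative functions. -/
noncomputable def discountOp (φ f : S → ℝ≥0∞) (x : S) : ℝ≥0∞ := φ x * ∫⁻ y, f y ∂(g x)

variable {g} {φ : S → ℝ≥0∞}

theorem measurable_discountOp_iterate (hφ : Measurable φ) {f : S → ℝ≥0∞} (hf : Measurable f)
    (n : ℕ) : Measurable ((discountOp g φ)^[n] f) := by
  induction n with
  | zero => exact hf
  | succ n ih =>
    rw [Function.iterate_succ_apply']
    exact hφ.mul ih.lintegral_kernel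

variable {η : Kernel S ℝ}

theorem measurable_laplace (s : ℝ) : Measurable fun x => laplace (η x) s :=
  (StronglyMeasurable.integral_kernel (κ := η) (f := fun y : ℝ => Real.exp (-(s * y)))
    (by fun_prop : Continuous _).stronglyMeasurable).measurable

variable (g η) in
/-- The Laplace transform of the Markov renewal measure, as the Neumann series of the discounted
transition operator. -/
noncomputable def renewalLaplace (A : Set S) (s : ℝ) (x : S) : ℝ≥0∞ :=
  ∑' n, (discountOp g fun y => ENNReal.ofReal (laplace (η y) s))^[n] (A.indicator 1) x

theorem measurable_renewalLaplace {A : Set S} (hA : MeasurableSet A) (s : ℝ) :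
    Measurable (renewalLaplace g η A s) :=
  Measurable.tsum fun n =>
    measurable_discountOp_iterate (measurable_laplace s).ennreal_ofReal
      (measurable_one.indicator hA) n

/-- The Markov renewal equation for the Laplace transform, from the first step. -/
theorem renewalLaplace_eq {A : Set S} (hA : MeasurableSet A) (s : ℝ) (x : S) :
    renewalLaplace g η A s x = A.indicator 1 x +
      ENNReal.ofReal (laplace (η x) s) * ∫⁻ y, renewalLaplace g η A s y ∂(g x) := by
  unfold renewalLaplace
  rw [tsum_eq_zero_add' ENNReal.summable, lintegral_tsum fun n =>
    (measurable_discountOp_iterate (measurable_laplace s).ennreal_ofReal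
      (measurable_one.indicator hA) n).aemeasurable, ← ENNReal.tsum_mul_left]
  simp_rw [Function.iterate_succ_apply']
  rfl

variable [IsMarkovKernel g]

theorem lintegral_chainLaw_prod (hφ : Measurable φ) (x : S) (n : ℕ) :
    ∀ {f : S → ℝ≥0∞}, Measurable f →
      ∫⁻ ω, (∏ j ∈ Finset.range n, φ (ω j)) * f (ω n) ∂(chainLaw g x) =
        (discountOp g φ)^[n] f x := by
  induction n with
  | zero =>
    intro f hf
    simp only [Finset.range_zero, Finset.prod_empty, one_mul, Function.iterate_zero, id]
    rw [lintegral_chainLaw_eval g x 0 hf, pow_zero]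
    exact lintegral_dirac' x hf
  | succ n ih =>
    intro f hf
    have hF : Measurable fun h : (i : Finset.Iic n) → S => ∏ j : Finset.Iic n, φ (h j) :=
      Finset.measurable_prod _ fun j _ => hφ.comp (measurable_pi_apply j)
    have h1 := lintegral_chainLaw_succ g x n hF hf
    have h2 : ∀ ω : ℕ → S, ∏ j : Finset.Iic n, φ (Preorder.frestrictLe (π := fun _ => S) n ω j) =
        ∏ j ∈ Finset.range (n + 1), φ (ω j) := fun ω => by
      rw [Nat.range_succ_eq_Iic]
      exact Finset.prod_coe_sort (Finset.Iic n) fun j => φ (ω j)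
    simp_rw [h2] at h1
    rw [h1, Function.iterate_succ_apply,
      ← ih (f := discountOp g φ f) (hφ.mul hf.lintegral_kernel)]
    refine lintegral_congr fun ω => ?_
    rw [Finset.prod_range_succ, mul_assoc]
    rfl

theorem renewalLaplace_le {A : Set S} {s q : ℝ} (hq1 : q < 1)
    (hq : ∀ x, laplace (η x) s ≤ q) (x : S) :
    renewalLaplace g η A s x ≤ ENNReal.ofReal (1 - q)⁻¹ := by
  have hq0 : 0 ≤ q := (laplace_nonneg s).trans (hq x)
  have h1 : ∀ n, ∀ x, (discountOp g fun y => ENNReal.ofReal (laplace (η y) s))^[n]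
      (A.indicator 1) x ≤ ENNReal.ofReal q ^ n := by
    intro n
    induction n with
    | zero =>
      intro x
      rw [pow_zero]
      exact Set.indicator_le_self' (by simp) x
    | succ n ih =>
      intro x
      rw [Function.iterate_succ_apply', pow_succ']
      refine mul_le_mul' (ENNReal.ofReal_le_ofReal (hq x)) ?_
      calc _ ≤ ∫⁻ _, ENNReal.ofReal q ^ n ∂(g x) := lintegral_mono ih
        _ = _ := by simp
  calc renewalLaplace g η A s x ≤ ∑' n, ENNReal.ofReal q ^ n := ENNReal.tsum_le_tsum fun n => h1 n x
    _ = ENNReal.ofReal (1 - q)⁻¹ := by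
      rw [ENNReal.tsum_geometric, ENNReal.ofReal_inv_of_pos (by linarith),
        ENNReal.ofReal_sub _ hq0, ENNReal.ofReal_one]

variable [IsMarkovKernel η]

/-- The Laplace–Stieltjes transform in `t` of `P_x(S_n ≤ t, Λ_n ∈ A)`. -/
theorem lintegral_law_exp (hη : ∀ x, η x (Set.Iio 0) = 0) {s : ℝ} (hs : 0 ≤ s)
    {A : Set S} (hA : MeasurableSet A) (x : S) (n : ℕ) :
    ∫⁻ ω, ENNReal.ofReal (Real.exp (-(s * ∑ j ∈ Finset.range n, ω.2 j))) *
        A.indicator 1 (ω.1 n) ∂(law g η x) =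
      (discountOp g fun y => ENNReal.ofReal (laplace (η y) s))^[n] (A.indicator 1) x := by
  have hexp : Measurable fun y : ℝ => ENNReal.ofReal (Real.exp (-(s * y))) := by fun_prop
  have hAm : Measurable (A.indicator (1 : S → ℝ≥0∞)) := measurable_one.indicator hA
  have hpr : ∀ y : ℕ → ℝ, ENNReal.ofReal (Real.exp (-(s * ∑ j ∈ Finset.range n, y j))) =
      ∏ j ∈ Finset.range n, ENNReal.ofReal (Real.exp (-(s * y j))) := fun y => by
    rw [← ENNReal.ofReal_prod_of_nonneg fun _ _ => (Real.exp_pos _).le, ← Real.exp_sum,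
      Finset.mul_sum, Finset.sum_neg_distrib]
  rw [← lintegral_chainLaw_prod (measurable_laplace s).ennreal_ofReal x n hAm, law,
    Measure.lintegral_compProd]
  · refine lintegral_congr fun ω => ?_
    change ∫⁻ y, ENNReal.ofReal (Real.exp (-(s * ∑ j ∈ Finset.range n, y j))) *
      A.indicator 1 (ω n) ∂(Measure.infinitePi fun j => η (ω j)) = _
    simp_rw [hpr]
    rw [lintegral_mul_const]
    · congr 1
      rw [lintegral_prod_eq_prod_lintegral_of_indepFun (Finset.range n)
        (fun j (y : ℕ → ℝ) => ENNReal.ofReal (Real.exp (-(s * y j))))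
        (iIndepFun_infinitePi (fun _ => hexp))
        (fun j => hexp.comp (measurable_pi_apply j))]
      refine Finset.prod_congr rfl fun j _ => ?_
      rw [← lintegral_exp_eq_laplace (hη (ω j)) hs]
      have := (measurePreserving_eval_infinitePi (fun j => η (ω j)) j).lintegral_comp hexp
      exact this
    · exact Finset.measurable_prod _ fun j _ => hexp.comp (measurable_pi_apply j)
  · refine Measurable.mul ?_ (hAm.comp ((measurable_pi_apply n).comp measurable_fst))
    refine hexp.comp (Finset.measurable_sum _ fun j _ => ?_)
    exact (measurable_pi_apply j).comp measurable_snd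

theorem ae_law_nonneg (hη : ∀ x, η x (Set.Iio 0) = 0) (x : S) :
    ∀ᵐ ω ∂(law g η x), ∀ j, 0 ≤ ω.2 j := by
  rw [ae_all_iff]
  intro j
  have hm : Measurable fun ω : (ℕ → S) × (ℕ → ℝ) => ω.2 j :=
    (measurable_pi_apply j).comp measurable_snd
  refine Measure.ae_compProd_of_ae_ae (measurableSet_le measurable_const hm) ?_
  refine Eventually.of_forall fun ω => ?_
  exact (measurePreserving_eval_infinitePi (fun j => η (ω j)) j).quasiMeasurePreserving.ae
    (ae_nonneg_of_measure_Iio (hη (ω j)))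

theorem lintegral_exp_mul_renewalMeasure (hη : ∀ x, η x (Set.Iio 0) = 0) {s : ℝ} (hs : 0 < s)
    {A : Set S} (hA : MeasurableSet A) (x : S) :
    ∫⁻ t in Set.Ioi 0, ENNReal.ofReal (s * Real.exp (-(s * t))) * renewalMeasure g η x t A =
      renewalLaplace g η A s x := by
  have hSm : ∀ n, Measurable fun ω : (ℕ → S) × (ℕ → ℝ) => ∑ j ∈ Finset.range n, ω.2 j :=
    fun n => Finset.measurable_sum _ fun j _ => (measurable_pi_apply j).comp measurable_snd
  have hΛm : ∀ n, Measurable fun ω : (ℕ → S) × (ℕ → ℝ) => ω.1 n :=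
    fun n => (measurable_pi_apply n).comp measurable_fst
  have hset : ∀ n, MeasurableSet {p : ℝ × ((ℕ → S) × (ℕ → ℝ)) |
      ∑ j ∈ Finset.range n, p.2.2 j ≤ p.1 ∧ p.2.1 n ∈ A} := fun n =>
    (measurableSet_le ((hSm n).comp measurable_snd) measurable_fst).inter
      (((hΛm n).comp measurable_snd) hA)
  have hfac : ∀ (n : ℕ) (t : ℝ), law g η x {ω | ∑ j ∈ Finset.range n, ω.2 j ≤ t ∧ ω.1 n ∈ A} =
      ∫⁻ ω, {p : ℝ × ((ℕ → S) × (ℕ → ℝ)) |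
        ∑ j ∈ Finset.range n, p.2.2 j ≤ p.1 ∧ p.2.1 n ∈ A}.indicator 1 (t, ω) ∂(law g η x) := by
    intro n t
    exact (lintegral_indicator_one (μ := law g η x)
      ((hset n).preimage (measurable_const.prodMk measurable_id : Measurable fun ω => (t, ω)))).symm
  have hpm : ∀ n, Measurable fun t : ℝ =>
      law g η x {ω | ∑ j ∈ Finset.range n, ω.2 j ≤ t ∧ ω.1 n ∈ A} := fun n => by
    simp_rw [hfac]
    have : SFinite (law g η x) := by unfold law; infer_instance
    exact (measurable_one.indicator (hset n)).lintegral_prod_right'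
  unfold renewalMeasure renewalLaplace
  simp_rw [← ENNReal.tsum_mul_left]
  rw [lintegral_tsum (f := fun n t => ENNReal.ofReal (s * Real.exp (-(s * t))) *
    law g η x {ω | ∑ j ∈ Finset.range n, ω.2 j ≤ t ∧ ω.1 n ∈ A}) fun n =>
    ((by fun_prop : Measurable fun t : ℝ =>
      ENNReal.ofReal (s * Real.exp (-(s * t)))).mul (hpm n)).aemeasurable]
  congr 1
  ext n
  rw [← lintegral_law_exp hη hs.le hA x n]
  simp_rw [hfac]
  have : SFinite (law g η x) := by unfold law; infer_instance
  have e1 : ∀ t : ℝ, ENNReal.ofReal (s * Real.exp (-(s * t))) *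
      ∫⁻ ω, {p : ℝ × ((ℕ → S) × (ℕ → ℝ)) |
        ∑ j ∈ Finset.range n, p.2.2 j ≤ p.1 ∧ p.2.1 n ∈ A}.indicator 1 (t, ω) ∂(law g η x) =
      ∫⁻ ω, ENNReal.ofReal (s * Real.exp (-(s * t))) * {p : ℝ × ((ℕ → S) × (ℕ → ℝ)) |
        ∑ j ∈ Finset.range n, p.2.2 j ≤ p.1 ∧ p.2.1 n ∈ A}.indicator 1 (t, ω) ∂(law g η x) :=
    fun t => (lintegral_const_mul _ ((measurable_one.indicator (hset n)).comp
      (measurable_const.prodMk measurable_id))).symm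
  simp_rw [e1]
  rw [lintegral_lintegral_swap]
  · refine lintegral_congr_ae ?_
    filter_upwards [ae_law_nonneg hη x] with ω hω
    rw [← lintegral_exp_mul_indicator_Ici hs (Finset.sum_nonneg fun j _ => hω j),
      ← lintegral_mul_const]
    · refine lintegral_congr fun t => ?_
      rw [mul_assoc]
      congr 1
      simp only [Set.indicator_apply, Set.mem_Ici, Pi.one_apply]
      by_cases h1 : ∑ j ∈ Finset.range n, ω.2 j ≤ t <;> by_cases h2 : ω.1 n ∈ A <;> simp [h1, h2]
    · exact (by fun_prop : Measurable fun t : ℝ => ENNReal.ofReal (s * Real.exp (-(s * t)))).mul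
        (measurable_one.indicator measurableSet_Ici)
  · exact (((by fun_prop : Measurable fun t : ℝ =>
      ENNReal.ofReal (s * Real.exp (-(s * t)))).comp measurable_fst).mul
        (measurable_one.indicator (hset n))).aemeasurable

theorem renewalMeasure_mono (x : S) (A : Set S) :
    Monotone fun t => renewalMeasure g η x t A := fun _ _ h =>
  ENNReal.tsum_le_tsum fun _ => measure_mono fun _ hω => ⟨hω.1.trans h, hω.2⟩

theorem renewalMeasure_ne_top (hη : ∀ x, η x (Set.Iio 0) = 0) {A : Set S} (hA : MeasurableSet A)
    {s : ℝ} (hs : 0 < s) {x : S} (hfin : renewalLaplace g η A s x ≠ ⊤) (t : ℝ) :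
    renewalMeasure g η x t A ≠ ⊤ := by
  set T := max t 0 with hT
  have h1 : ENNReal.ofReal (Real.exp (-(s * T))) * renewalMeasure g η x T A ≤
      renewalLaplace g η A s x := by
    rw [← lintegral_exp_mul_renewalMeasure hη hs hA x,
      ← lintegral_exp_mul_indicator_Ici hs (le_max_right t 0), ← lintegral_mul_const]
    · refine lintegral_mono fun u => ?_
      rw [mul_assoc]
      refine mul_le_mul' le_rfl ?_
      by_cases hu : u ∈ Set.Ici T
      · rw [Set.indicator_of_mem hu, Pi.one_apply, one_mul]
        exact renewalMeasure_mono x A hu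
      · rw [Set.indicator_of_notMem hu, zero_mul]
        exact zero_le
    · exact (by fun_prop : Measurable fun t : ℝ => ENNReal.ofReal (s * Real.exp (-(s * t)))).mul
        (measurable_one.indicator measurableSet_Ici)
  refine ne_top_of_le_ne_top ?_ (renewalMeasure_mono x A (le_max_left t 0))
  intro h2
  change renewalMeasure g η x T A = ⊤ at h2
  rw [h2, ENNReal.mul_top (by simpa using Real.exp_pos _)] at h1
  exact hfin (top_le_iff.1 h1)

/-- Asymptotics of the Markov renewal measure from the behaviour of the Laplace transforms of the
waiting times at zero. Here `ψ` is the common order of magnitude of `1 - laplace (η x)`, regularly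
varying at zero, and `w x` is the limit of the ratio. -/
theorem tendsto_renewalMeasure (hη : ∀ x, η x (Set.Iio 0) = 0) (hH : HarrisRecurrent g)
    {ρ : Measure S} [IsProbabilityMeasure ρ] (hρ : Kernel.Invariant g ρ) {A : Set S}
    (hA : MeasurableSet A) {ψ q : ℝ → ℝ} {C r : ℝ} (hr : 0 ≤ r)
    (hψ : ∀ s, 0 < s → 0 < ψ s) (hψ0 : Tendsto ψ (𝓝[>] 0) (𝓝 0))
    (hreg : ∀ c : ℝ, 0 < c → Tendsto (fun T => ψ (c / T) / ψ (1 / T)) atTop (𝓝 (c ^ r)))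
    (hq1 : ∀ s, 0 < s → q s < 1) (hq : ∀ s, 0 < s → ∀ x, laplace (η x) s ≤ q s)
    (hqC : ∀ᶠ s in 𝓝[>] 0, ψ s ≤ C * (1 - q s))
    {w W : S → ℝ} (hW : Integrable W ρ)
    (hbd : ∀ᶠ s in 𝓝[>] 0, ∀ᵐ x ∂ρ, |(1 - laplace (η x) s) / ψ s| ≤ W x)
    (hw : ∀ᵐ x ∂ρ, Tendsto (fun s => (1 - laplace (η x) s) / ψ s) (𝓝[>] 0) (𝓝 (w x)))
    (hw0 : 0 < ∫ x, w x ∂ρ) (x : S) :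
    Tendsto (fun T => ψ (1 / T) * (renewalMeasure g η x T A).toReal) atTop
      (𝓝 (ρ.real A / (∫ x, w x ∂ρ) / Real.Gamma (1 + r))) := by
  have hfin : ∀ s, 0 < s → ∀ x, renewalLaplace g η A s x ≠ ⊤ := fun s hs x =>
    ne_top_of_le_ne_top ENNReal.ofReal_ne_top (renewalLaplace_le (hq1 s hs) (hq s hs) x)
  have hUfin := renewalMeasure_ne_top (g := g) hη hA one_pos (hfin 1 one_pos x)
  have hUm : Monotone fun t => (renewalMeasure g η x t A).toReal := fun _ _ h =>
    ENNReal.toReal_mono (hUfin _) (renewalMeasure_mono x A h)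
  have hlint : ∀ s, 0 < s → ∫⁻ t in Set.Ioi 0, ENNReal.ofReal
      (s * (Real.exp (-(s * t)) * (renewalMeasure g η x t A).toReal)) =
      renewalLaplace g η A s x := by
    intro s hs
    rw [← lintegral_exp_mul_renewalMeasure hη hs hA x]
    refine lintegral_congr fun t => ?_
    rw [← mul_assoc, ENNReal.ofReal_mul (by positivity), ENNReal.ofReal_toReal (hUfin t)]
  have hmeas : ∀ s, Measurable fun t =>
      s * (Real.exp (-(s * t)) * (renewalMeasure g η x t A).toReal) := fun s => by
    have := hUm.measurable
    fun_prop
  have hnn : ∀ s, 0 < s → ∀ t,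
      0 ≤ s * (Real.exp (-(s * t)) * (renewalMeasure g η x t A).toReal) := fun s hs t => by
    positivity
  have hUi' : ∀ s, 0 < s → IntegrableOn
      (fun t => s * (Real.exp (-(s * t)) * (renewalMeasure g η x t A).toReal)) (Set.Ioi 0) := by
    intro s hs
    refine ⟨(hmeas s).aestronglyMeasurable, ?_⟩
    rw [hasFiniteIntegral_iff_ofReal (Eventually.of_forall (hnn s hs)), hlint s hs]
    exact (hfin s hs x).lt_top
  refine tendsto_of_laplace_regularlyVarying hr (by positivity)
    (fun t => ENNReal.toReal_nonneg) hUm hψ ?_ ?_ hreg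
  · intro s hs
    refine ((hUi' s hs).const_mul s⁻¹).congr (Eventually.of_forall fun t => ?_)
    simp only
    rw [← mul_assoc, inv_mul_cancel₀ hs.ne', one_mul]
  · have h1 : Tendsto (fun s => ψ s * (renewalLaplace g η A s x).toReal) (𝓝[>] 0)
        (𝓝 (ρ.real A / ∫ x, w x ∂ρ)) := by
      refine tendsto_mul_of_renewal_equation (C := C) hH hρ hA
        (f := fun s x => laplace (η x) s) (R := fun s x => (renewalLaplace g η A s x).toReal)
        ?_ hψ0 (fun s => (measurable_renewalLaplace hA s).ennreal_toReal)
        (fun s => measurable_laplace s) ?_ ?_ (fun x => tendsto_laplace_zero (hη x)) hW hbd hw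
        hw0.ne' x
      · filter_upwards [self_mem_nhdsWithin] with s hs using hψ s hs
      · filter_upwards [self_mem_nhdsWithin, hqC] with s hs hc x
        have h2 := ENNReal.toReal_mono ENNReal.ofReal_ne_top
          (renewalLaplace_le (g := g) (A := A) (hq1 s hs) (hq s hs) x)
        have h3 : 0 < 1 - q s := by linarith [hq1 s hs]
        rw [ENNReal.toReal_ofReal (by positivity)] at h2
        rw [abs_of_nonneg (mul_nonneg (hψ s hs).le ENNReal.toReal_nonneg)]
        calc _ ≤ ψ s * (1 - q s)⁻¹ := mul_le_mul_of_nonneg_left h2 (hψ s hs).le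
          _ ≤ C * (1 - q s) * (1 - q s)⁻¹ := by gcongr
          _ = C := by field_simp
      · filter_upwards [self_mem_nhdsWithin] with s hs x
        have h2 : ∫⁻ y, renewalLaplace g η A s y ∂(g x) ≤ ENNReal.ofReal (1 - q s)⁻¹ := by
          calc _ ≤ ∫⁻ _, ENNReal.ofReal (1 - q s)⁻¹ ∂(g x) :=
                lintegral_mono fun y => renewalLaplace_le (hq1 s hs) (hq s hs) y
            _ = _ := by simp
        rw [renewalLaplace_eq hA, ENNReal.toReal_add, ENNReal.toReal_mul,
          ENNReal.toReal_ofReal (laplace_nonneg s), integral_toReal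
          (measurable_renewalLaplace hA s).aemeasurable
          (Eventually.of_forall fun y => (hfin s hs y).lt_top)]
        · congr 1
          by_cases hx : x ∈ A <;> simp [hx]
        · by_cases hx : x ∈ A <;> simp [hx]
        · exact ENNReal.mul_ne_top ENNReal.ofReal_ne_top
            (ne_top_of_le_ne_top ENNReal.ofReal_ne_top h2)
    refine h1.congr' ?_
    filter_upwards [self_mem_nhdsWithin] with s hs
    congr 1
    rw [← integral_const_mul, integral_eq_lintegral_of_nonneg_ae
      (Eventually.of_forall (hnn s hs)) (hmeas s).aestronglyMeasurable, hlint s hs]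

end Renewal

/-! ### Integrated tails and Abelian theorems -/

section Primitive

variable {f : ℝ → ℝ}

theorem intervalIntegral_mono_right (hf : Antitone f) (hf0 : ∀ t, 0 ≤ f t) {u v : ℝ}
    (huv : u ≤ v) : ∫ x in (0 : ℝ)..u, f x ≤ ∫ x in (0 : ℝ)..v, f x := by
  rw [← intervalIntegral.integral_add_adjacent_intervals (hf.intervalIntegrable (a := 0) (b := u))
    (hf.intervalIntegrable (a := u) (b := v))]
  linarith [intervalIntegral.integral_nonneg (μ := volume) huv fun x _ => hf0 x]

theorem intervalIntegral_le_add (hf : Antitone f) {u v : ℝ} (huv : u ≤ v) :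
    ∫ x in (0 : ℝ)..v, f x ≤ (∫ x in (0 : ℝ)..u, f x) + (v - u) * f u := by
  rw [← intervalIntegral.integral_add_adjacent_intervals (hf.intervalIntegrable (a := 0) (b := u))
    (hf.intervalIntegrable (a := u) (b := v))]
  have := intervalIntegral.integral_mono_on (μ := volume) huv
    (hf.intervalIntegrable (a := u) (b := v))
    (intervalIntegrable_const (c := f u)) fun x hx => hf hx.1
  rw [intervalIntegral.integral_const, smul_eq_mul] at this
  linarith

theorem add_le_intervalIntegral (hf : Antitone f) {u v : ℝ} (huv : u ≤ v) :
    (∫ x in (0 : ℝ)..u, f x) + (v - u) * f v ≤ ∫ x in (0 : ℝ)..v, f x := by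
  rw [← intervalIntegral.integral_add_adjacent_intervals (hf.intervalIntegrable (a := 0) (b := u))
    (hf.intervalIntegrable (a := u) (b := v))]
  have := intervalIntegral.integral_mono_on (μ := volume) huv (intervalIntegrable_const (c := f v))
    (hf.intervalIntegrable (a := u) (b := v)) fun x hx => hf hx.2
  rw [intervalIntegral.integral_const, smul_eq_mul] at this
  linarith

theorem intervalIntegral_pos_of_antitone (hf : Antitone f) (hpos : ∀ t, 0 < t → 0 < f t) {t : ℝ}
    (ht : 0 < t) : 0 < ∫ x in (0 : ℝ)..t, f x := by
  have := add_le_intervalIntegral hf ht.le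
  rw [intervalIntegral.integral_same, zero_add, sub_zero] at this
  exact (mul_pos ht (hpos t ht)).trans_le this

theorem intervalIntegral_scale {T : ℝ} (hT : 0 < T) :
    ∫ x in (0 : ℝ)..T, f x = T * ∫ x in (0 : ℝ)..1, f (T * x) := by
  rw [intervalIntegral.integral_comp_mul_left _ hT.ne', smul_eq_mul, mul_zero, mul_one,
    ← mul_assoc, mul_inv_cancel₀ hT.ne', one_mul]

/-- The primitive of a nonnegative nonincreasing function grows at most linearly. -/
theorem intervalIntegral_mul_le (hf : Antitone f) (hf0 : ∀ t, 0 ≤ f t) {T x : ℝ}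
    (hT : 0 < T) (hx : 0 < x) :
    ∫ u in (0 : ℝ)..(T * x), f u ≤ (1 + x) * ∫ u in (0 : ℝ)..T, f u := by
  have hI : 0 ≤ ∫ u in (0 : ℝ)..T, f u := intervalIntegral.integral_nonneg hT.le fun u _ => hf0 u
  rcases le_total x 1 with h | h
  · have := intervalIntegral_mono_right hf hf0 (u := T * x) (v := T) (by nlinarith)
    nlinarith
  · have h1 : ∫ u in (0 : ℝ)..(T * x), f u = x * ∫ u in (0 : ℝ)..T, f (x * u) := by
      rw [intervalIntegral.integral_comp_mul_left _ hx.ne', smul_eq_mul, mul_zero, ← mul_assoc,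
        mul_inv_cancel₀ hx.ne', one_mul, mul_comm T x]
    have h2 : ∫ u in (0 : ℝ)..T, f (x * u) ≤ ∫ u in (0 : ℝ)..T, f u := by
      refine intervalIntegral.integral_mono_on hT.le ?_ hf.intervalIntegrable fun u hu => ?_
      · have : Antitone fun u => f (x * u) := fun u v huv =>
          hf (mul_le_mul_of_nonneg_left huv hx.le)
        exact this.intervalIntegrable
      · exact hf (by nlinarith [hu.1])
    rw [h1]
    nlinarith

/-- Karamata's theorem on the integral of a regularly varying function of index `-α > -1`, for
nonincreasing functions. The convergence is dominated thanks to the bound `f (T x) ≤ K x ^ (-β) f T`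
with `α < β < 1`, which follows from `f (t / 2) ≤ 2 ^ β f t` by iteration. -/
theorem tendsto_intervalIntegral_div (hf : Antitone f) (hf1 : ∀ t, f t ≤ 1)
    (hpos : ∀ t, 0 < t → 0 < f t) {α : ℝ} (hα0 : 0 ≤ α) (hα1 : α < 1)
    (hreg : ∀ c : ℝ, 0 < c → Tendsto (fun T => f (T * c) / f T) atTop (𝓝 (c ^ (-α)))) :
    Tendsto (fun T => (∫ x in (0 : ℝ)..T, f x) / (T * f T)) atTop (𝓝 (1 - α)⁻¹) := by
  set β := (1 + α) / 2 with hβ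
  have hβα : α < β := by linarith
  have hβ1 : β < 1 := by linarith
  have hβ0 : 0 < β := by linarith
  obtain ⟨T₀, hT₀1, hdbl⟩ : ∃ T₀ : ℝ, 1 ≤ T₀ ∧ ∀ t, T₀ ≤ t → f (t * (1 / 2)) ≤ 2 ^ β * f t := by
    have h1 := hreg (1 / 2) (by norm_num)
    have h2 : ((1 : ℝ) / 2) ^ (-α) < 2 ^ β := by
      rw [one_div, Real.inv_rpow (by norm_num), Real.rpow_neg (by norm_num), inv_inv]
      exact Real.rpow_lt_rpow_of_exponent_lt (by norm_num) hβα
    obtain ⟨T₁, h3⟩ := eventually_atTop.1 (h1.eventually (gt_mem_nhds h2))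
    refine ⟨max T₁ 1, le_max_right _ _, fun t ht => ?_⟩
    have ht0 : 0 < t := by linarith [le_max_right T₁ 1]
    have := h3 t (le_trans (le_max_left _ _) ht)
    rw [div_lt_iff₀ (hpos t ht0)] at this
    exact this.le
  have hT₀ : 0 < T₀ := by linarith
  have hiter : ∀ n : ℕ, ∀ T, T₀ ≤ T * (1 / 2) ^ n → f (T * (1 / 2) ^ (n + 1)) ≤
      ((2 : ℝ) ^ β) ^ (n + 1) * f T := by
    intro n
    induction n with
    | zero =>
      intro T hT
      simpa using hdbl T (by simpa using hT)
    | succ n ih =>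
      intro T hT
      have h1 : 0 ≤ T * (1 / 2) ^ n := by
        have : T * (1 / 2) ^ (n + 1) = T * (1 / 2) ^ n / 2 := by ring
        linarith
      have h2 := hdbl (T * (1 / 2) ^ (n + 1)) hT
      have h3 := ih T (by
        have : T * (1 / 2) ^ (n + 1) = T * (1 / 2) ^ n / 2 := by ring
        linarith)
      calc f (T * (1 / 2) ^ (n + 1 + 1)) = f (T * (1 / 2) ^ (n + 1) * (1 / 2)) := by
            congr 1; ring
        _ ≤ 2 ^ β * f (T * (1 / 2) ^ (n + 1)) := h2
        _ ≤ 2 ^ β * (((2 : ℝ) ^ β) ^ (n + 1) * f T) := by gcongr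
        _ = _ := by ring
  have hpot1 : ∀ T x, 0 < x → x ≤ 1 → T₀ ≤ T * x → f (T * x) ≤ 2 ^ β * x ^ (-β) * f T := by
    intro T x hx hx1 hTx
    have hT : 0 < T := by
      by_contra h
      nlinarith
    obtain ⟨n, hn1, hn2⟩ := exists_nat_pow_near_of_lt_one hx hx1 (y := 1 / 2) (by norm_num)
      (by norm_num)
    have h1 := hiter n T (hTx.trans (by gcongr))
    have h2 : f (T * x) ≤ f (T * (1 / 2) ^ (n + 1)) := hf (by gcongr)
    refine (h2.trans h1).trans ?_
    have h3 : ((2 : ℝ) ^ β) ^ n ≤ x ^ (-β) := by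
      have h4 : ((1 / 2 : ℝ) ^ n) ^ (-β) ≤ x ^ (-β) :=
        Real.rpow_le_rpow_of_nonpos hx hn2 (by linarith)
      refine le_trans (le_of_eq ?_) h4
      rw [one_div, inv_pow, Real.inv_rpow (by positivity), Real.rpow_neg (by positivity), inv_inv,
        ← Real.rpow_natCast, ← Real.rpow_natCast, ← Real.rpow_mul (by norm_num),
        ← Real.rpow_mul (by norm_num), mul_comm]
    rw [pow_succ']
    have := (hpos T hT).le
    gcongr
  set K : ℝ := (f T₀)⁻¹ * 2 ^ β with hK
  have hfT₀ := hpos T₀ hT₀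
  have hpot : ∀ T x, T₀ ≤ T → 0 < x → x ≤ 1 → f (T * x) / f T ≤ K * x ^ (-β) := by
    intro T x hT hx hx1
    have hT0 : 0 < T := by linarith
    rw [div_le_iff₀ (hpos T hT0)]
    have hinv : 1 ≤ (f T₀)⁻¹ := (one_le_inv₀ hfT₀).2 (hf1 _)
    -- below `T₀` the value at `T x` is at most one, and `T₀` itself is compared with `T`
    rcases le_total T₀ (T * x) with h | h
    · refine (hpot1 T x hx hx1 h).trans ?_
      have : 0 ≤ 2 ^ β * x ^ (-β) * f T := by
        have := (hpos T hT0).le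
        positivity
      calc 2 ^ β * x ^ (-β) * f T ≤ (f T₀)⁻¹ * (2 ^ β * x ^ (-β) * f T) := by nlinarith
        _ = K * x ^ (-β) * f T := by rw [hK]; ring
    · have h1 := hpot1 T (T₀ / T) (by positivity) ((div_le_one hT0).2 hT)
        (by rw [mul_div_cancel₀ _ hT0.ne'])
      rw [mul_div_cancel₀ _ hT0.ne'] at h1
      have h2 : (T₀ / T) ^ (-β) ≤ x ^ (-β) :=
        Real.rpow_le_rpow_of_nonpos hx ((le_div_iff₀ hT0).2 (by linarith)) (by linarith)
      have h3 : f T₀ ≤ 2 ^ β * x ^ (-β) * f T := by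
        refine h1.trans ?_
        have := (hpos T hT0).le
        gcongr
      calc f (T * x) ≤ 1 := hf1 _
        _ = (f T₀)⁻¹ * f T₀ := (inv_mul_cancel₀ hfT₀.ne').symm
        _ ≤ (f T₀)⁻¹ * (2 ^ β * x ^ (-β) * f T) := by gcongr
        _ = K * x ^ (-β) * f T := by rw [hK]; ring
  have hlim : Tendsto (fun T => ∫ x in (0 : ℝ)..1, f (T * x) / f T) atTop
      (𝓝 (∫ x in (0 : ℝ)..1, x ^ (-α))) := by
    refine intervalIntegral.tendsto_integral_filter_of_dominated_convergence
      (fun x => K * x ^ (-β)) ?_ ?_ ?_ ?_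
    · refine Eventually.of_forall fun T => ?_
      exact ((hf.measurable.comp (measurable_const_mul T)).div_const _).aestronglyMeasurable
    · filter_upwards [eventually_ge_atTop T₀] with T hT
      refine Eventually.of_forall fun x hx => ?_
      rw [Set.uIoc_of_le zero_le_one] at hx
      have hT0 : 0 < T := by linarith
      rw [Real.norm_eq_abs, abs_of_nonneg (div_nonneg (hpos _ (mul_pos hT0 hx.1)).le
        (hpos T hT0).le)]
      exact hpot T x hT hx.1 hx.2
    · exact (intervalIntegral.intervalIntegrable_rpow' (by linarith)).const_mul K
    · refine Eventually.of_forall fun x hx => ?_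
      rw [Set.uIoc_of_le zero_le_one] at hx
      exact hreg x hx.1
  rw [integral_rpow (Or.inl (by linarith)), Real.one_rpow, Real.zero_rpow (by linarith)] at hlim
  have e : (1 - 0) / (-α + 1) = (1 - α)⁻¹ := by rw [sub_zero, one_div, neg_add_eq_sub]
  rw [e] at hlim
  refine hlim.congr' ?_
  filter_upwards [eventually_gt_atTop 0] with T hT
  rw [intervalIntegral.integral_div, intervalIntegral_scale hT]
  have := hpos T hT
  field_simp

/-- In the boundary case of index `-1`, the function is negligible with respect to its average. The
intervals `[T / 2 ^ (j + 1), T / 2 ^ j]` contribute about `T f(T) / 2` each to the integral. -/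
theorem tendsto_mul_div_intervalIntegral (hf : Antitone f) (hpos : ∀ t, 0 < t → 0 < f t)
    (hreg : ∀ c : ℝ, 0 < c → Tendsto (fun T => (T * c * f (T * c)) / (T * f T)) atTop (𝓝 1)) :
    Tendsto (fun T => T * f T / ∫ x in (0 : ℝ)..T, f x) atTop (𝓝 0) := by
  have hk : ∀ k : ℕ, ∀ᶠ T in atTop, (k / 4 : ℝ) * (T * f T) ≤ ∫ x in (0 : ℝ)..T, f x := by
    intro k
    induction k with
    | zero =>
      filter_upwards [eventually_gt_atTop 0] with T hT
      simpa using (intervalIntegral_pos_of_antitone hf hpos hT).le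
    | succ k ih =>
      have h1 : ∀ᶠ T in atTop, (1 - 1 / (k + 1) : ℝ) <
          (T * (1 / 2) * f (T * (1 / 2))) / (T * f T) :=
        (hreg (1 / 2) (by norm_num)).eventually (lt_mem_nhds (by
          have : (0 : ℝ) < 1 / (k + 1) := by positivity
          linarith))
      have h2 : Tendsto (fun T : ℝ => T * (1 / 2)) atTop atTop :=
        tendsto_id.atTop_mul_const (by norm_num)
      filter_upwards [h1, h2.eventually ih, eventually_gt_atTop 0] with T h3 h4 hT
      have h5 := add_le_intervalIntegral hf (u := T * (1 / 2)) (v := T) (by linarith)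
      have h6 : 0 < T * f T := mul_pos hT (hpos T hT)
      rw [lt_div_iff₀ h6] at h3
      have h7 : (k / 4 : ℝ) * ((1 - 1 / (k + 1)) * (T * f T)) ≤
          (k / 4 : ℝ) * (T * (1 / 2) * f (T * (1 / 2))) :=
        mul_le_mul_of_nonneg_left h3.le (by positivity)
      have h8 : (k / 4 : ℝ) * (1 - 1 / (k + 1)) = k / 4 - (k / (k + 1)) / 4 := by
        field_simp
      have h9 : (k : ℝ) / (k + 1) ≤ 1 := (div_le_one (by positivity)).2 (by linarith)
      rw [← mul_assoc, h8] at h7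
      push_cast
      nlinarith
  rw [tendsto_order]
  constructor
  · intro a ha
    filter_upwards [eventually_gt_atTop 0] with T hT
    exact ha.trans (div_pos (mul_pos hT (hpos T hT)) (intervalIntegral_pos_of_antitone hf hpos hT))
  · intro a ha
    obtain ⟨k, hk'⟩ := exists_nat_gt (4 / a)
    have hk0 : (0 : ℝ) < k := lt_trans (by positivity) hk'
    filter_upwards [hk k, eventually_gt_atTop 0] with T h1 hT
    have hI := intervalIntegral_pos_of_antitone hf hpos hT
    rw [div_lt_iff₀ hI]
    rw [div_lt_iff₀ ha] at hk'
    have h6 : 0 < T * f T := mul_pos hT (hpos T hT)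
    nlinarith

theorem tendsto_intervalIntegral_scale_of_tendsto_zero (hf : Antitone f) (hf0 : ∀ t, 0 ≤ f t)
    (hpos : ∀ t, 0 < t → 0 < f t)
    (h0 : Tendsto (fun T => T * f T / ∫ x in (0 : ℝ)..T, f x) atTop (𝓝 0)) {c : ℝ} (hc : 0 < c) :
    Tendsto (fun T => (∫ x in (0 : ℝ)..(T * c), f x) / ∫ x in (0 : ℝ)..T, f x) atTop (𝓝 1) := by
  have key : ∀ c : ℝ, 1 ≤ c →
      Tendsto (fun T => (∫ x in (0 : ℝ)..(T * c), f x) / ∫ x in (0 : ℝ)..T, f x) atTop (𝓝 1) := by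
    intro c hc
    have h1 : Tendsto (fun T => 1 + (c - 1) * (T * f T / ∫ x in (0 : ℝ)..T, f x)) atTop (𝓝 1) := by
      simpa using (h0.const_mul (c - 1)).const_add 1
    refine tendsto_of_tendsto_of_tendsto_of_le_of_le' tendsto_const_nhds h1 ?_ ?_
    · filter_upwards [eventually_gt_atTop 0] with T hT
      rw [one_le_div (intervalIntegral_pos_of_antitone hf hpos hT)]
      exact intervalIntegral_mono_right hf hf0 (by nlinarith)
    · filter_upwards [eventually_gt_atTop 0] with T hT
      have hI := intervalIntegral_pos_of_antitone hf hpos hT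
      have h2 := intervalIntegral_le_add hf (u := T) (v := T * c) (by nlinarith)
      rw [div_le_iff₀ hI, add_mul, one_mul, mul_assoc, div_mul_cancel₀ _ hI.ne']
      linarith
  rcases le_total 1 c with h | h
  · exact key c h
  · have h1 : Tendsto (fun T : ℝ => T * c) atTop atTop := tendsto_id.atTop_mul_const hc
    have h2 := ((key c⁻¹ ((one_le_inv₀ hc).2 h)).comp h1).inv₀ one_ne_zero
    rw [inv_one] at h2
    refine h2.congr fun T => ?_
    simp only [Function.comp]
    rw [inv_div, mul_assoc, mul_inv_cancel₀ hc.ne', mul_one]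

end Primitive

section LaplaceTail

/-- Integration by parts for the Laplace transform of a measure on `[0, ∞)`. -/
theorem lintegral_exp_mul_measure_Iic {ν : Measure ℝ} [SFinite ν] (h0 : ν (Set.Iio 0) = 0) {s : ℝ}
    (hs : 0 < s) :
    ∫⁻ t in Set.Ioi 0, ENNReal.ofReal (s * Real.exp (-(s * t))) * ν (Set.Iic t) =
      ∫⁻ x, ENNReal.ofReal (Real.exp (-(s * x))) ∂ν := by
  have hset : MeasurableSet {p : ℝ × ℝ | p.2 ≤ p.1} :=
    measurableSet_le measurable_snd measurable_fst
  have hm : Measurable fun t : ℝ => ENNReal.ofReal (s * Real.exp (-(s * t))) := by fun_prop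
  have e1 : ∀ t, ENNReal.ofReal (s * Real.exp (-(s * t))) * ν (Set.Iic t) =
      ∫⁻ x, ENNReal.ofReal (s * Real.exp (-(s * t))) *
        {p : ℝ × ℝ | p.2 ≤ p.1}.indicator 1 (t, x) ∂ν := fun t => by
    refine Eq.symm ((lintegral_const_mul _ ((measurable_one.indicator hset).comp
      (measurable_const.prodMk measurable_id))).trans ?_)
    congr 1
    exact lintegral_indicator_one (μ := ν) measurableSet_Iic
  simp_rw [e1]
  rw [lintegral_lintegral_swap]
  · refine lintegral_congr_ae ?_
    filter_upwards [ae_nonneg_of_measure_Iio h0] with x hx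
    rw [← lintegral_exp_mul_indicator_Ici hs hx]
    refine lintegral_congr fun t => ?_
    congr 1
  · exact ((hm.comp measurable_fst).mul (measurable_one.indicator hset)).aemeasurable

variable {m : Measure ℝ}

theorem antitone_one_sub_cdf : Antitone fun t => 1 - cdf m t := fun _ _ h =>
  sub_le_sub_left (monotone_cdf m h) 1

variable [IsProbabilityMeasure m]

/-- The Laplace transform of a law in terms of the integrated tail. -/
theorem one_sub_laplace_eq (h0 : m (Set.Iio 0) = 0) {s : ℝ} (hs : 0 < s) :
    IntegrableOn (fun t => Real.exp (-(s * t)) * ∫ u in (0 : ℝ)..t, (1 - cdf m u)) (Set.Ioi 0) ∧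
    1 - laplace m s =
      s * (s * ∫ t in Set.Ioi 0, Real.exp (-(s * t)) * ∫ u in (0 : ℝ)..t, (1 - cdf m u)) := by
  have hanti : Antitone fun t => 1 - cdf m t := antitone_one_sub_cdf
  have hf0 : ∀ t, 0 ≤ 1 - cdf m t := fun t => sub_nonneg.2 (cdf_le_one m t)
  have hf1 : ∀ t, 1 - cdf m t ≤ 1 := fun t => sub_le_self _ (cdf_nonneg m t)
  have hexp : IntegrableOn (fun t => Real.exp (-(s * t))) (Set.Ioi 0) := by
    have := integrableOn_exp_mul_Ioi (neg_lt_zero.2 hs) 0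
    simpa only [neg_mul] using this
  have hexp1 : ∫ t in Set.Ioi 0, Real.exp (-(s * t)) = s⁻¹ := by
    have := integral_exp_mul_Ioi (neg_lt_zero.2 hs) 0
    simp only [neg_mul, mul_zero, Real.exp_zero] at this
    rw [this, neg_div_neg_eq, one_div]
  have hFi : IntegrableOn (fun t => Real.exp (-(s * t)) * (1 - cdf m t)) (Set.Ioi 0) := by
    refine Integrable.mul_bdd (c := 1) hexp hanti.measurable.aestronglyMeasurable ?_
    exact Eventually.of_forall fun t => by
      rw [Real.norm_eq_abs, abs_of_nonneg (hf0 t)]; exact hf1 t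
  have hFi' : IntegrableOn (fun t => Real.exp (-(s * t)) * cdf m t) (Set.Ioi 0) := by
    refine Integrable.mul_bdd (c := 1) hexp (monotone_cdf m).measurable.aestronglyMeasurable ?_
    exact Eventually.of_forall fun t => by
      rw [Real.norm_eq_abs, abs_of_nonneg (cdf_nonneg m t)]; exact cdf_le_one m t
  have h1 : laplace m s = s * ∫ t in Set.Ioi 0, Real.exp (-(s * t)) * cdf m t := by
    rw [← integral_const_mul]
    have e1 := lintegral_exp_mul_measure_Iic h0 hs
    rw [lintegral_exp_eq_laplace h0 hs.le] at e1
    have e2 : ∀ t, ENNReal.ofReal (s * Real.exp (-(s * t))) * m (Set.Iic t) =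
        ENNReal.ofReal (s * (Real.exp (-(s * t)) * cdf m t)) := fun t => by
      rw [← ofReal_cdf, ← ENNReal.ofReal_mul (by positivity), mul_assoc]
    simp_rw [e2] at e1
    rw [← ofReal_integral_eq_lintegral_ofReal (hFi'.const_mul s)
      (Eventually.of_forall fun t => mul_nonneg hs.le
        (mul_nonneg (Real.exp_pos _).le (cdf_nonneg m t)))] at e1
    exact ((ENNReal.ofReal_eq_ofReal_iff (integral_nonneg fun t => mul_nonneg hs.le
        (mul_nonneg (Real.exp_pos _).le (cdf_nonneg m t))) (laplace_nonneg s)).1 e1).symm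
  have h2 : 1 - laplace m s = s * ∫ t in Set.Ioi 0, Real.exp (-(s * t)) * (1 - cdf m t) := by
    simp_rw [mul_sub, mul_one]
    rw [integral_sub hexp hFi', hexp1, mul_sub, mul_inv_cancel₀ hs.ne', h1]
  -- the measure with density `1 - cdf m` has the integrated tail as its distribution function
  set ν : Measure ℝ := (volume.restrict (Set.Ioi 0)).withDensity
    fun t => ENNReal.ofReal (1 - cdf m t) with hν
  have hν0 : ν (Set.Iio 0) = 0 := by
    rw [hν, withDensity_apply _ measurableSet_Iio, Measure.restrict_restrict measurableSet_Iio]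
    have : Set.Iio (0 : ℝ) ∩ Set.Ioi 0 = ∅ := by
      ext x; simp only [Set.mem_inter_iff, Set.mem_Iio, Set.mem_Ioi, Set.mem_empty_iff_false,
        iff_false, not_and, not_lt]; exact fun h => h.le
    rw [this]; simp
  have hνI : ∀ t, 0 < t → ν (Set.Iic t) = ENNReal.ofReal (∫ u in (0 : ℝ)..t, (1 - cdf m u)) := by
    intro t ht
    rw [hν, withDensity_apply _ measurableSet_Iic, Measure.restrict_restrict measurableSet_Iic,
      Set.inter_comm, Set.Ioi_inter_Iic, intervalIntegral.integral_of_le ht.le,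
      ofReal_integral_eq_lintegral_ofReal _ (Eventually.of_forall hf0)]
    exact (intervalIntegrable_iff_integrableOn_Ioc_of_le ht.le).1 hanti.intervalIntegrable
  have hdens : ∫⁻ x, ENNReal.ofReal (Real.exp (-(s * x))) ∂ν =
      ENNReal.ofReal (∫ t in Set.Ioi 0, Real.exp (-(s * t)) * (1 - cdf m t)) := by
    rw [hν, lintegral_withDensity_eq_lintegral_mul _ hanti.measurable.ennreal_ofReal (by fun_prop),
      ofReal_integral_eq_lintegral_ofReal hFi (Eventually.of_forall fun t =>
        mul_nonneg (Real.exp_pos _).le (hf0 t))]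
    refine lintegral_congr fun t => ?_
    rw [Pi.mul_apply, mul_comm, ← ENNReal.ofReal_mul (Real.exp_pos _).le]
  have hton := lintegral_exp_mul_measure_Iic hν0 hs
  rw [hdens] at hton
  have hnn : 0 ≤ᵐ[volume.restrict (Set.Ioi 0)]
      fun t => s * (Real.exp (-(s * t)) * ∫ u in (0 : ℝ)..t, (1 - cdf m u)) := by
    filter_upwards [ae_restrict_mem measurableSet_Ioi] with t ht
    have ht' : (0 : ℝ) < t := ht
    have := intervalIntegral.integral_nonneg (μ := volume) ht'.le fun u _ => hf0 u
    exact mul_nonneg hs.le (mul_nonneg (Real.exp_pos _).le this)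
  have hmeas : Measurable fun t =>
      s * (Real.exp (-(s * t)) * ∫ u in (0 : ℝ)..t, (1 - cdf m u)) := by
    have h3 : Monotone fun t => ∫ u in (0 : ℝ)..t, (1 - cdf m u) := fun u v huv =>
      intervalIntegral_mono_right hanti hf0 huv
    have := h3.measurable
    fun_prop
  have hlint : ∫⁻ t in Set.Ioi 0, ENNReal.ofReal
      (s * (Real.exp (-(s * t)) * ∫ u in (0 : ℝ)..t, (1 - cdf m u))) =
      ENNReal.ofReal (∫ t in Set.Ioi 0, Real.exp (-(s * t)) * (1 - cdf m t)) := by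
    rw [← hton]
    refine setLIntegral_congr_fun measurableSet_Ioi fun t ht => ?_
    rw [hνI t ht, ← ENNReal.ofReal_mul (by positivity), mul_assoc]
  constructor
  · have : IntegrableOn (fun t => s * (Real.exp (-(s * t)) *
        ∫ u in (0 : ℝ)..t, (1 - cdf m u))) (Set.Ioi 0) := by
      refine ⟨hmeas.aestronglyMeasurable, ?_⟩
      rw [hasFiniteIntegral_iff_ofReal hnn, hlint]
      exact ENNReal.ofReal_lt_top
    refine (this.const_mul s⁻¹).congr (Eventually.of_forall fun t => ?_)
    simp only
    rw [← mul_assoc, inv_mul_cancel₀ hs.ne', one_mul]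
  · rw [h2, ← integral_const_mul s (fun t => Real.exp (-(s * t)) *
      ∫ u in (0 : ℝ)..t, (1 - cdf m u)), integral_eq_lintegral_of_nonneg_ae hnn
      hmeas.aestronglyMeasurable, hlint, ENNReal.toReal_ofReal]
    exact integral_nonneg fun t => mul_nonneg (Real.exp_pos _).le (hf0 t)

/-- Abelian theorem: if the integrated tail varies regularly with index `β`, then
`1 - laplace m (1 / T)` is asymptotic to `Γ(1 + β) / T` times the integrated tail at `T`. -/
theorem tendsto_one_sub_laplace_div (h0 : m (Set.Iio 0) = 0)
    (hpos : ∀ t, 0 < t → 0 < 1 - cdf m t) {β : ℝ} (hβ : 0 ≤ β)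
    (hreg : ∀ c : ℝ, 0 < c → Tendsto (fun T => (∫ u in (0 : ℝ)..(T * c), (1 - cdf m u)) /
      ∫ u in (0 : ℝ)..T, (1 - cdf m u)) atTop (𝓝 (c ^ β))) :
    Tendsto (fun T => (1 - laplace m (1 / T)) * T / ∫ u in (0 : ℝ)..T, (1 - cdf m u)) atTop
      (𝓝 (Real.Gamma (1 + β))) := by
  have hanti : Antitone fun t => 1 - cdf m t := antitone_one_sub_cdf
  have hf0 : ∀ t, 0 ≤ 1 - cdf m t := fun t => sub_nonneg.2 (cdf_le_one m t)
  have hmono : Monotone fun t => ∫ u in (0 : ℝ)..t, (1 - cdf m u) := fun u v huv =>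
    intervalIntegral_mono_right hanti hf0 huv
  have hlim : Tendsto (fun T => ∫ x in Set.Ioi 0, Real.exp (-x) *
      ((∫ u in (0 : ℝ)..(T * x), (1 - cdf m u)) / ∫ u in (0 : ℝ)..T, (1 - cdf m u))) atTop
      (𝓝 (∫ x in Set.Ioi 0, Real.exp (-x) * x ^ β)) := by
    refine tendsto_integral_filter_of_dominated_convergence
      (fun x => Real.exp (-x) * x ^ ((1 : ℝ) - 1) + Real.exp (-x) * x ^ ((2 : ℝ) - 1)) ?_ ?_ ?_ ?_
    · refine Eventually.of_forall fun T => ?_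
      have h1 := hmono.measurable.comp (measurable_const_mul T)
      have h2 : Measurable fun x => ∫ u in (0 : ℝ)..(T * x), (1 - cdf m u) := h1
      exact ((by fun_prop : Measurable fun x : ℝ => Real.exp (-x)).mul
        (h2.div_const _)).aestronglyMeasurable
    · filter_upwards [eventually_gt_atTop 0] with T hT
      filter_upwards [ae_restrict_mem measurableSet_Ioi] with x hx
      have hx' : (0 : ℝ) < x := hx
      have hI := intervalIntegral_pos_of_antitone hanti hpos hT
      have hI' := intervalIntegral_pos_of_antitone hanti hpos (mul_pos hT hx')
      rw [Real.norm_eq_abs, abs_of_nonneg (by positivity), ← mul_add]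
      refine mul_le_mul_of_nonneg_left ?_ (Real.exp_pos _).le
      rw [div_le_iff₀ hI, sub_self, Real.rpow_zero]
      norm_num only [Real.rpow_one]
      exact intervalIntegral_mul_le hanti hf0 hT hx'
    · exact (Real.GammaIntegral_convergent one_pos).add (Real.GammaIntegral_convergent two_pos)
    · filter_upwards [ae_restrict_mem measurableSet_Ioi] with x hx
      exact (hreg x hx).const_mul _
  have hΓ : Real.Gamma (1 + β) = ∫ x in Set.Ioi 0, Real.exp (-x) * x ^ β := by
    rw [Real.Gamma_eq_integral (by linarith), add_sub_cancel_left]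
  rw [hΓ]
  refine hlim.congr' ?_
  filter_upwards [eventually_gt_atTop 0] with T hT
  have hs : 0 < 1 / T := by positivity
  have hsub := integral_comp_mul_left_Ioi
    (fun t => Real.exp (-(1 / T * t)) * ∫ u in (0 : ℝ)..t, (1 - cdf m u)) 0 hT
  rw [mul_zero, smul_eq_mul, ← one_div] at hsub
  rw [(one_sub_laplace_eq h0 hs).2, ← hsub, mul_right_comm, one_div_mul_cancel hT.ne', one_mul,
    ← integral_div]
  refine integral_congr_ae (Eventually.of_forall fun x => ?_)
  simp only
  rw [← mul_assoc (1 / T), one_div_mul_cancel hT.ne', one_mul, mul_div_assoc]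

theorem tendsto_one_sub_laplace_scale (h0 : m (Set.Iio 0) = 0)
    (hpos : ∀ t, 0 < t → 0 < 1 - cdf m t) {β : ℝ} (hβ : 0 ≤ β)
    (hreg : ∀ c : ℝ, 0 < c → Tendsto (fun T => (∫ u in (0 : ℝ)..(T * c), (1 - cdf m u)) /
      ∫ u in (0 : ℝ)..T, (1 - cdf m u)) atTop (𝓝 (c ^ β))) {c : ℝ} (hc : 0 < c) :
    Tendsto (fun T => (1 - laplace m (c / T)) / (1 - laplace m (1 / T))) atTop
      (𝓝 (c ^ (1 - β))) := by
  have hanti : Antitone fun t => 1 - cdf m t := antitone_one_sub_cdf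
  have hΓ : 0 < Real.Gamma (1 + β) := Real.Gamma_pos_of_pos (by linarith)
  have h1 := tendsto_one_sub_laplace_div h0 hpos hβ hreg
  have hT : Tendsto (fun T : ℝ => T * c⁻¹) atTop atTop :=
    tendsto_id.atTop_mul_const (inv_pos.2 hc)
  have h2 := (((h1.comp hT).div h1 hΓ.ne').mul (hreg c⁻¹ (inv_pos.2 hc))).mul_const c
  have e : Real.Gamma (1 + β) / Real.Gamma (1 + β) * c⁻¹ ^ β * c = c ^ (1 - β) := by
    rw [div_self hΓ.ne', one_mul, Real.rpow_sub hc, Real.rpow_one, Real.inv_rpow hc.le]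
    field_simp
  rw [e] at h2
  refine h2.congr' ?_
  filter_upwards [eventually_gt_atTop 0] with T hT
  have hI := intervalIntegral_pos_of_antitone hanti hpos hT
  have hI' := intervalIntegral_pos_of_antitone hanti hpos (mul_pos hT (inv_pos.2 hc))
  have e2 : 1 / (T * c⁻¹) = c / T := by field_simp
  simp only [Pi.div_apply, Function.comp, e2]
  generalize (∫ u in (0 : ℝ)..(T * c⁻¹), (1 - cdf m u)) = J at hI' ⊢
  field_simp

end LaplaceTail

/-! ### Finite stationary mean and families of scaled type -/

section FiniteMean

variable {μ : Measure ℝ} [IsProbabilityMeasure μ]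

/-- Waiting times that exceed `δ` with probability at least `1 - c` have a Laplace transform
bounded away from one. -/
theorem laplace_le_of_cdf_le (h0 : μ (Set.Iio 0) = 0) {δ c s : ℝ} (hδ : 0 ≤ δ) (hs : 0 ≤ s)
    (hc : cdf μ δ ≤ c) : laplace μ s ≤ 1 - (1 - c) * (1 - Real.exp (-(s * δ))) := by
  have h1 : laplace μ s ≤ ∫ x, (Real.exp (-(s * δ)) +
      (1 - Real.exp (-(s * δ))) * (Set.Iic δ).indicator 1 x) ∂μ := by
    refine integral_mono_ae (integrable_exp_neg h0 hs) ?_ ?_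
    · exact (integrable_const _).add
        (((integrable_const (1 : ℝ)).indicator measurableSet_Iic).const_mul _)
    · filter_upwards [ae_nonneg_of_measure_Iio h0] with x hx
      by_cases hxδ : x ∈ Set.Iic δ
      · rw [Set.indicator_of_mem hxδ, Pi.one_apply, mul_one, add_sub_cancel, Real.exp_le_one_iff]
        have := mul_nonneg hs hx
        linarith
      · rw [Set.indicator_of_notMem hxδ, mul_zero, add_zero, Real.exp_le_exp]
        have : δ ≤ x := (not_le.1 hxδ).le
        nlinarith
  have h3 : Integrable (fun x => (1 - Real.exp (-(s * δ))) *
      (Set.Iic δ).indicator (1 : ℝ → ℝ) x) μ :=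
    ((integrable_const (1 : ℝ)).indicator measurableSet_Iic).const_mul _
  rw [integral_add (integrable_const _) h3, integral_const_mul,
    integral_indicator_one measurableSet_Iic, ← cdf_eq_real] at h1
  simp only [integral_const, probReal_univ, one_smul] at h1
  have h2 : Real.exp (-(s * δ)) ≤ 1 := by
    rw [Real.exp_le_one_iff]
    have := mul_nonneg hs hδ
    linarith
  nlinarith

theorem one_sub_exp_neg_mem_Icc {s x : ℝ} (hs : 0 < s) (hx : 0 ≤ x) :
    0 ≤ (1 - Real.exp (-(s * x))) / s ∧ (1 - Real.exp (-(s * x))) / s ≤ x := by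
  constructor
  · refine div_nonneg (sub_nonneg.2 ?_) hs.le
    rw [Real.exp_le_one_iff]
    have := mul_nonneg hs.le hx
    linarith
  · rw [div_le_iff₀ hs]
    have := Real.add_one_le_exp (-(s * x))
    linarith

theorem one_sub_laplace_div_eq (h0 : μ (Set.Iio 0) = 0) {s : ℝ} (hs : 0 < s) :
    (1 - laplace μ s) / s = ∫ x, (1 - Real.exp (-(s * x))) / s ∂μ := by
  rw [integral_div, integral_sub (integrable_const _) (integrable_exp_neg h0 hs.le)]
  simp [laplace]

theorem abs_one_sub_laplace_div_le (h0 : μ (Set.Iio 0) = 0)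
    (hi : Integrable (fun x : ℝ => x) μ) {s : ℝ} (hs : 0 < s) :
    |(1 - laplace μ s) / s| ≤ ∫ x, x ∂μ := by
  rw [abs_of_nonneg (div_nonneg (sub_nonneg.2 (laplace_le_one h0 hs.le)) hs.le),
    one_sub_laplace_div_eq h0 hs]
  refine integral_mono_ae (((integrable_const _).sub (integrable_exp_neg h0 hs.le)).div_const _)
    hi ?_
  filter_upwards [ae_nonneg_of_measure_Iio h0] with x hx
  exact (one_sub_exp_neg_mem_Icc hs hx).2

theorem tendsto_one_sub_laplace_div_self (h0 : μ (Set.Iio 0) = 0)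
    (hi : Integrable (fun x : ℝ => x) μ) :
    Tendsto (fun s => (1 - laplace μ s) / s) (𝓝[>] 0) (𝓝 (∫ x, x ∂μ)) := by
  have h1 : Tendsto (fun s : ℝ => ∫ x, (1 - Real.exp (-(s * x))) / s ∂μ) (𝓝[>] 0)
      (𝓝 (∫ x, x ∂μ)) := by
    refine tendsto_integral_filter_of_dominated_convergence (fun x => x) ?_ ?_ hi ?_
    · exact Eventually.of_forall fun s => by fun_prop
    · filter_upwards [self_mem_nhdsWithin] with s hs
      filter_upwards [ae_nonneg_of_measure_Iio h0] with x hx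
      have := one_sub_exp_neg_mem_Icc (s := s) hs hx
      rw [Real.norm_eq_abs, abs_of_nonneg this.1]
      exact this.2
    · refine Eventually.of_forall fun x => ?_
      have hd : HasDerivAt (fun s : ℝ => -Real.exp (-(s * x))) x 0 := by
        have h2 : HasDerivAt (fun s : ℝ => -(s * x)) (-x) 0 := by
          exact (hasDerivAt_mul_const x).fun_neg
        have := h2.exp.fun_neg
        simpa using this
      have h3 := hd.tendsto_slope.mono_left
        (nhdsWithin_mono 0 fun s (hs : (0 : ℝ) < s) => (hs.ne' : s ≠ 0))
      refine h3.congr fun s => ?_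
      rw [slope_def_field]
      simp only [zero_mul, neg_zero, Real.exp_zero, sub_zero]
      ring
  refine h1.congr' ?_
  filter_upwards [self_mem_nhdsWithin] with s hs
  exact (one_sub_laplace_div_eq h0 hs).symm

theorem isEquivalent_of_tendsto_mul {u v p : ℝ → ℝ} {c : ℝ} (hc : c ≠ 0)
    (hu : Tendsto (fun t => p t * u t) atTop (𝓝 c)) (hv : ∀ᶠ t in atTop, p t * v t = c) :
    u ~[atTop] v := by
  refine isEquivalent_of_tendsto_one ?_
  have h1 := hu.div_const c
  rw [div_self hc] at h1
  refine h1.congr' ?_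
  filter_upwards [hv] with t ht
  have hp : p t ≠ 0 := fun h => hc (by rw [← ht, h, zero_mul])
  rw [Pi.div_apply, ← ht, mul_div_mul_left _ _ hp]

variable {S : Type*} [MeasurableSpace S] {g : Kernel S S} [IsMarkovKernel g]
  {η : Kernel S ℝ} [IsMarkovKernel η]

theorem renewalMeasure_isEquivalent_of_meanWaiting_lt_top (hη : BasicAssumptions η)
    (hH : HarrisRecurrent g) {ρ : Measure S} [IsProbabilityMeasure ρ]
    (hρ : Kernel.Invariant g ρ) {A : Set S} (hA : MeasurableSet A) (hρA : 0 < ρ A) (x : S)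
    (hmean : meanWaiting η ρ < ⊤) :
    (fun t : ℝ => (renewalMeasure g η x t A).toReal) ~[atTop]
      fun t : ℝ => t / (meanWaiting η ρ).toReal * ρ.real A := by
  obtain ⟨δ, hδ, c, hc1, hc⟩ := hη.not_small
  have hρA' : 0 < ρ.real A := ENNReal.toReal_pos hρA.ne' (measure_ne_top _ _)
  have hmeas : Measurable fun y => ∫⁻ x, ENNReal.ofReal x ∂(η y) :=
    Measurable.lintegral_kernel (by fun_prop)
  have hint : ∀ᵐ y ∂ρ, Integrable (fun x : ℝ => x) (η y) := by
    filter_upwards [ae_lt_top hmeas hmean.ne] with y hy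
    refine ⟨by fun_prop, ?_⟩
    rw [hasFiniteIntegral_iff_ofReal (ae_nonneg_of_measure_Iio (hη.nonneg y))]
    exact hy
  have hw : ∀ y, ∫ x, x ∂(η y) = (∫⁻ x, ENNReal.ofReal x ∂(η y)).toReal := fun y =>
    integral_eq_lintegral_of_nonneg_ae (ae_nonneg_of_measure_Iio (hη.nonneg y)) (by fun_prop)
  have hwint : Integrable (fun y => ∫ x, x ∂(η y)) ρ := by
    simp_rw [hw]
    exact integrable_toReal_of_lintegral_ne_top hmeas.aemeasurable hmean.ne
  have hwmean : ∫ y, ∫ x, x ∂(η y) ∂ρ = (meanWaiting η ρ).toReal := by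
    simp_rw [hw]
    exact integral_toReal hmeas.aemeasurable (ae_lt_top hmeas hmean.ne)
  have hpos : 0 < (meanWaiting η ρ).toReal := by
    rw [← hwmean]
    have h1 : δ * (1 - c) ≤ ∫ y, ∫ x, x ∂(η y) ∂ρ := by
      have h2 : ∫ _, δ * (1 - c) ∂ρ = δ * (1 - c) := by simp
      rw [← h2]
      refine integral_mono_ae (integrable_const _) hwint ?_
      filter_upwards [hint] with y hy
      have h3 : ∫ x, (δ - δ * (Set.Iic δ).indicator 1 x) ∂(η y) ≤ ∫ x, x ∂(η y) := by
        refine integral_mono_ae ((integrable_const _).sub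
          (((integrable_const (1 : ℝ)).indicator measurableSet_Iic).const_mul _)) hy ?_
        filter_upwards [ae_nonneg_of_measure_Iio (hη.nonneg y)] with x hx
        by_cases hxδ : x ∈ Set.Iic δ
        · rw [Set.indicator_of_mem hxδ]; simpa using hx
        · rw [Set.indicator_of_notMem hxδ]; simpa using (not_le.1 hxδ).le
      have h4 : Integrable (fun x => δ * (Set.Iic δ).indicator (1 : ℝ → ℝ) x) (η y) :=
        ((integrable_const (1 : ℝ)).indicator measurableSet_Iic).const_mul _
      rw [integral_sub (integrable_const _) h4, integral_const_mul,
        integral_indicator_one measurableSet_Iic, ← cdf_eq_real] at h3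
      simp only [integral_const, probReal_univ, one_smul] at h3
      have := hc y
      nlinarith
    exact (mul_pos hδ (by linarith)).trans_le h1
  have hexp1 : ∀ s, 0 < s → Real.exp (-(s * δ)) < 1 := fun s hs => by
    rw [Real.exp_lt_one_iff]
    have := mul_pos hs hδ
    linarith
  have key := tendsto_renewalMeasure (η := η) hη.nonneg hH hρ hA (ψ := fun s => s) (r := 1)
    (q := fun s => 1 - (1 - c) * (1 - Real.exp (-(s * δ)))) (C := 2 / ((1 - c) * δ))
    (w := fun y => ∫ x, x ∂(η y)) (W := fun y => ∫ x, x ∂(η y))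
    zero_le_one (fun s hs => hs) (tendsto_id.mono_left nhdsWithin_le_nhds) ?_ ?_ ?_ ?_ hwint ?_ ?_
    (by rw [hwmean]; exact hpos) x
  · rw [hwmean, show (1 : ℝ) + 1 = 2 by norm_num, Real.Gamma_two, div_one] at key
    refine isEquivalent_of_tendsto_mul (by positivity) key ?_
    filter_upwards [eventually_gt_atTop 0] with t ht
    field_simp
  · intro c hc
    rw [Real.rpow_one]
    refine tendsto_const_nhds.congr' ?_
    filter_upwards [eventually_gt_atTop 0] with T hT
    field_simp
  · intro s hs
    have := mul_pos (sub_pos.2 hc1) (sub_pos.2 (hexp1 s hs))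
    linarith
  · exact fun s hs y => laplace_le_of_cdf_le (hη.nonneg y) hδ.le (le_of_lt hs) (hc y)
  · -- for `s δ ≤ 1` one has `1 - exp (-s δ) ≥ s δ / (1 + s δ) ≥ s δ / 2`
    have h1 : Set.Ioo 0 δ⁻¹ ∈ 𝓝[>] (0 : ℝ) := Ioo_mem_nhdsGT (by positivity)
    filter_upwards [h1] with s hs
    have hsδ : 0 < s * δ := mul_pos hs.1 hδ
    have hsδ1 : s * δ < 1 := by
      have := mul_lt_mul_of_pos_right hs.2 hδ
      rwa [inv_mul_cancel₀ hδ.ne'] at this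
    have h2 : Real.exp (-(s * δ)) ≤ 1 - s * δ / 2 := by
      rw [Real.exp_neg]
      have h3 := Real.add_one_le_exp (s * δ)
      refine (inv_anti₀ (by linarith) h3).trans ?_
      rw [inv_le_iff_one_le_mul₀ (by linarith)]
      nlinarith
    have h4 : 0 < 1 - c := by linarith
    rw [sub_sub_cancel, ← mul_assoc, div_mul_eq_mul_div, mul_comm 2, mul_div_mul_left _ _ h4.ne',
      div_mul_eq_mul_div, le_div_iff₀ hδ]
    linarith
  · filter_upwards [self_mem_nhdsWithin] with s hs
    filter_upwards [hint] with y hy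
    exact abs_one_sub_laplace_div_le (hη.nonneg y) hy hs
  · filter_upwards [hint] with y hy
    exact tendsto_one_sub_laplace_div_self (hη.nonneg y) hy

end FiniteMean

section Scaled

variable {m : Measure ℝ} [IsProbabilityMeasure m]

theorem cdf_eq_zero_of_neg {μ : Measure ℝ} [IsProbabilityMeasure μ] (h0 : μ (Set.Iio 0) = 0)
    {t : ℝ} (ht : t < 0) : cdf μ t = 0 := by
  rw [cdf_eq_real, measureReal_def, measure_mono_null (Set.Iic_subset_Iio.2 ht) h0,
    ENNReal.toReal_zero]

theorem laplace_eq_of_cdf_scaled {μ : Measure ℝ} [IsProbabilityMeasure μ]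
    (hμ : μ (Set.Iio 0) = 0) (hm : m (Set.Iio 0) = 0) {c : ℝ} (hc : 0 < c)
    (h : ∀ t, 0 ≤ t → cdf μ t = cdf m (c * t)) (s : ℝ) : laplace μ s = laplace m (s / c) := by
  have hmeas : Measurable fun x : ℝ => x / c := measurable_id.div_const c
  have := Measure.isProbabilityMeasure_map (μ := m) hmeas.aemeasurable
  have heq : μ = m.map fun x => x / c := by
    refine Measure.eq_of_cdf _ _ ?_
    ext t
    have h1 : cdf (m.map fun x => x / c) t = cdf m (c * t) := by
      rw [cdf_eq_real, cdf_eq_real, map_measureReal_apply hmeas measurableSet_Iic]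
      congr 1
      ext x
      simp only [Set.mem_preimage, Set.mem_Iic]
      rw [div_le_iff₀ hc, mul_comm]
    rw [h1]
    rcases le_or_gt 0 t with ht | ht
    · exact h t ht
    · rw [cdf_eq_zero_of_neg hμ ht, cdf_eq_zero_of_neg hm (mul_neg_of_pos_of_neg hc ht)]
  rw [heq, laplace, integral_map hmeas.aemeasurable (by fun_prop)]
  refine integral_congr_ae (Eventually.of_forall fun x => ?_)
  simp only
  congr 2
  ring

theorem one_sub_laplace_pos (hm : m (Set.Iio 0) = 0) (hpos : ∀ t, 0 < t → 0 < 1 - cdf m t)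
    {s : ℝ} (hs : 0 < s) : 0 < 1 - laplace m s := by
  have h1 := laplace_le_of_cdf_le hm zero_le_one hs.le (le_refl (cdf m 1))
  have h2 : Real.exp (-(s * 1)) < 1 := by rw [Real.exp_lt_one_iff]; linarith
  have := mul_pos (hpos 1 one_pos) (sub_pos.2 h2)
  linarith

/-- This holds because `1 - laplace m` is nondecreasing, concave and zero at the origin. -/
theorem one_sub_laplace_mul_le (hm : m (Set.Iio 0) = 0) {c s : ℝ} (hc : 0 < c) (hs : 0 < s) :
    1 - laplace m (c * s) ≤ max 1 c * (1 - laplace m s) := by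
  have e : ∀ s : ℝ, 0 < s → 1 - laplace m s = ∫ x, (1 - Real.exp (-(s * x))) ∂m := fun s hs => by
    rw [integral_sub (integrable_const _) (integrable_exp_neg hm hs.le)]
    simp [laplace]
  rw [e _ (mul_pos hc hs), e _ hs, ← integral_const_mul]
  refine integral_mono_ae ((integrable_const _).sub (integrable_exp_neg hm (mul_pos hc hs).le))
    (((integrable_const _).sub (integrable_exp_neg hm hs.le)).const_mul _) ?_
  filter_upwards [ae_nonneg_of_measure_Iio hm] with x hx
  have hsx := mul_nonneg hs.le hx
  have h1 : Real.exp (-(s * x)) ≤ 1 := by rw [Real.exp_le_one_iff]; linarith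
  rcases le_total c 1 with h | h
  · rw [max_eq_left h, one_mul]
    refine sub_le_sub_left (Real.exp_le_exp.2 ?_) 1
    nlinarith
  · rw [max_eq_right h]
    -- Bernoulli's inequality for `exp (-s x) ^ c`
    have h2 := one_add_mul_self_le_rpow_one_add (s := Real.exp (-(s * x)) - 1)
      (by linarith [Real.exp_pos (-(s * x))]) h
    rw [add_sub_cancel, ← Real.exp_mul] at h2
    have h3 : -(c * s * x) = -(s * x) * c := by ring
    rw [h3]
    linarith

variable {a b : ℝ} {g : Kernel (Set.Icc a b) (Set.Icc a b)} [IsMarkovKernel g]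
  {η : Kernel (Set.Icc a b) ℝ} [IsMarkovKernel η]

theorem integral_rpow_neg_pos (ha : 0 < a) {ρ : Measure (Set.Icc a b)} [IsProbabilityMeasure ρ]
    {r : ℝ} (hr : 0 ≤ r) : 0 < ∫ l : Set.Icc a b, (l : ℝ) ^ (-r) ∂ρ := by
  obtain ⟨l₀⟩ : Nonempty (Set.Icc a b) := by
    by_contra h
    rw [not_nonempty_iff] at h
    have := measure_univ (μ := ρ)
    rw [Measure.eq_zero_of_isEmpty ρ] at this
    simp at this
  have hb : 0 < b := ha.trans_le (l₀.2.1.trans l₀.2.2)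
  have hi : Integrable (fun l : Set.Icc a b => (l : ℝ) ^ (-r)) ρ := by
    refine integrable_of_bdd (C := a ^ (-r)) (by fun_prop) fun l => ?_
    have hl : 0 < (l : ℝ) := ha.trans_le l.2.1
    rw [abs_of_nonneg (by positivity)]
    exact Real.rpow_le_rpow_of_nonpos ha l.2.1 (by linarith)
  have h1 : ∫ _, b ^ (-r) ∂ρ ≤ ∫ l : Set.Icc a b, (l : ℝ) ^ (-r) ∂ρ :=
    integral_mono (integrable_const _) hi fun l =>
      Real.rpow_le_rpow_of_nonpos (ha.trans_le l.2.1) l.2.2 (by linarith)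
  have h2 : ∫ _, b ^ (-r) ∂ρ = b ^ (-r) := by simp
  rw [h2] at h1
  exact (Real.rpow_pos_of_pos hb _).trans_le h1

/-- For a family of scaled type, the growth of the Markov renewal measure is read off from the
integrated tail of the ancestor law, when this varies regularly with index `1 - α`. -/
theorem tendsto_renewalMeasure_of_scaledType (hη : ∀ l, η l (Set.Iio 0) = 0)
    (hH : HarrisRecurrent g) {ρ : Measure (Set.Icc a b)} [IsProbabilityMeasure ρ]
    (hρ : Kernel.Invariant g ρ) {A : Set (Set.Icc a b)} (hA : MeasurableSet A) (ha : 0 < a)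
    (hm : m (Set.Iio 0) = 0) (hsc : ScaledType η m) (hpos : ∀ t, 0 < t → 0 < 1 - cdf m t)
    {α : ℝ} (hα0 : 0 ≤ α) (hα1 : α ≤ 1)
    (hreg : ∀ c : ℝ, 0 < c → Tendsto (fun T => (∫ u in (0 : ℝ)..(T * c), (1 - cdf m u)) /
      ∫ u in (0 : ℝ)..T, (1 - cdf m u)) atTop (𝓝 (c ^ (1 - α)))) (l₀ : Set.Icc a b) :
    Tendsto (fun T => (∫ u in (0 : ℝ)..T, (1 - cdf m u)) / T *
      (renewalMeasure g η l₀ T A).toReal) atTop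
      (𝓝 (ρ.real A / (∫ l : Set.Icc a b, (l : ℝ) ^ (-α) ∂ρ) / Real.Gamma (1 + α) /
        Real.Gamma (2 - α))) := by
  have hb : 0 < b := ha.trans_le (l₀.2.1.trans l₀.2.2)
  have hl : ∀ l : Set.Icc a b, 0 < (l : ℝ) := fun l => ha.trans_le l.2.1
  have hlap : ∀ (l : Set.Icc a b) s, laplace (η l) s = laplace m (s / l) := fun l =>
    laplace_eq_of_cdf_scaled (hη l) hm (hl l) (hsc l)
  have hψ : ∀ s, 0 < s → 0 < 1 - laplace m s := fun s hs => one_sub_laplace_pos hm hpos hs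
  have hscale : ∀ c : ℝ, 0 < c → Tendsto
      (fun T => (1 - laplace m (c / T)) / (1 - laplace m (1 / T))) atTop (𝓝 (c ^ α)) := by
    intro c hc
    have := tendsto_one_sub_laplace_scale hm hpos (by linarith) hreg hc
    rwa [sub_sub_cancel] at this
  have key := tendsto_renewalMeasure (g := g) (η := η) hη hH hρ hA (ψ := fun s => 1 - laplace m s)
    (r := α) (q := fun s => laplace m (s / b)) (C := max 1 b)
    (w := fun l : Set.Icc a b => (l : ℝ) ^ (-α)) (W := fun _ => max 1 a⁻¹) hα0 hψ ?_ hscale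
    (fun s hs => by linarith [hψ (s / b) (div_pos hs hb)]) ?_ ?_ (integrable_const _) ?_ ?_
    (integral_rpow_neg_pos ha hα0) l₀
  · have h1 := tendsto_one_sub_laplace_div hm hpos (by linarith) hreg
    rw [show 1 + (1 - α) = 2 - α by ring] at h1
    have hΓ : 0 < Real.Gamma (2 - α) := Real.Gamma_pos_of_pos (by linarith)
    refine (key.div h1 hΓ.ne').congr' ?_
    filter_upwards [eventually_gt_atTop 0] with T hT
    have h2 := intervalIntegral_pos_of_antitone antitone_one_sub_cdf hpos hT
    have h3 := hψ (1 / T) (by positivity)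
    simp only [Pi.div_apply]
    field_simp
  · simpa using (tendsto_laplace_zero hm).const_sub 1
  · intro s hs l
    rw [hlap]
    refine integral_mono_ae (integrable_exp_neg hm (div_pos hs (hl l)).le)
      (integrable_exp_neg hm (div_pos hs hb).le) ?_
    filter_upwards [ae_nonneg_of_measure_Iio hm] with x hx
    rw [Real.exp_le_exp, neg_le_neg_iff]
    exact mul_le_mul_of_nonneg_right (div_le_div_of_nonneg_left hs.le (hl l) l.2.2) hx
  · filter_upwards [self_mem_nhdsWithin] with s hs
    have := one_sub_laplace_mul_le hm hb (div_pos hs hb)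
    rwa [mul_div_cancel₀ _ hb.ne'] at this
  · filter_upwards [self_mem_nhdsWithin] with s hs
    refine Eventually.of_forall fun l => ?_
    have hs' : 0 < s := hs
    have h1 := one_sub_laplace_mul_le hm (inv_pos.2 (hl l)) hs'
    rw [hlap, abs_of_nonneg (div_nonneg (hψ _ (div_pos hs' (hl l))).le (hψ s hs').le),
      div_le_iff₀ (hψ s hs'), div_eq_inv_mul]
    refine h1.trans (mul_le_mul_of_nonneg_right ?_ (hψ s hs').le)
    exact max_le_max le_rfl (inv_anti₀ ha l.2.1)
  · refine Eventually.of_forall fun l => ?_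
    have h1 := (hscale (l : ℝ)⁻¹ (inv_pos.2 (hl l))).comp tendsto_inv_nhdsGT_zero
    rw [Real.inv_rpow (hl l).le, ← Real.rpow_neg (hl l).le] at h1
    refine h1.congr fun s => ?_
    simp only [Function.comp, hlap, div_inv_eq_mul, one_mul]
    rw [inv_mul_eq_div]

theorem Gamma_one_add_mul_Gamma_one_sub {α : ℝ} (hα0 : 0 ≤ α) (hα1 : α < 1) :
    (Real.Gamma (1 + α) * Real.Gamma (1 - α))⁻¹ = Real.sinc (Real.pi * α) := by
  rcases hα0.eq_or_lt with rfl | h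
  · simp
  · have h1 : Real.pi * α ≠ 0 := by positivity
    rw [add_comm, Real.Gamma_add_one h.ne', mul_assoc, Real.Gamma_mul_Gamma_one_sub,
      Real.sinc_of_ne_zero h1, mul_div_assoc', inv_div, mul_comm α]

theorem tendsto_mul_div_of_eq_rpow_mul {f L : ℝ → ℝ} {α : ℝ} (hL : SlowlyVarying L)
    (hf : ∀ t, 0 < t → f t = t ^ (-α) * L t) {c : ℝ} (hc : 0 < c) :
    Tendsto (fun T => f (T * c) / f T) atTop (𝓝 (c ^ (-α))) := by
  have h1 := (hL.2 c hc).const_mul (c ^ (-α))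
  rw [mul_one] at h1
  refine h1.congr' ?_
  filter_upwards [eventually_gt_atTop 0] with T hT
  have h2 := hL.1 T hT
  have h3 : 0 < T ^ (-α) := Real.rpow_pos_of_pos hT _
  rw [hf _ (mul_pos hT hc), hf T hT, Real.mul_rpow hT.le hc.le, mul_comm T c]
  field_simp

end Scaled

end MarkovRenewal

theorem mainTheorem2 (a b : ℝ)
    (η : Kernel (Set.Icc a b) ℝ) [IsMarkovKernel η] (hη : MarkovRenewal.BasicAssumptions η)
    (g : Kernel (Set.Icc a b) (Set.Icc a b)) [IsMarkovKernel g]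
    (hHarris : MarkovRenewal.HarrisRecurrent g) (hgap : MarkovRenewal.SpectralGap g)
    (ρ : Measure (Set.Icc a b)) [IsProbabilityMeasure ρ] (hρ : Kernel.Invariant g ρ)
    (A : Set (Set.Icc a b)) (hA : MeasurableSet A) (hρA : 0 < ρ A) (l₀ : Set.Icc a b) :
    -- finite stationary mean
    (MarkovRenewal.meanWaiting η ρ < ⊤ →
      (fun t : ℝ => (MarkovRenewal.renewalMeasure g η l₀ t A).toReal) ~[atTop]
        fun t : ℝ => t / (MarkovRenewal.meanWaiting η ρ).toReal * ρ.real A) ∧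
    -- scaled type with regularly varying tail
    (0 < a → ∀ (m : Measure ℝ) [IsProbabilityMeasure m], m (Set.Iio 0) = 0 →
      MarkovRenewal.ScaledType η m → ∀ L : ℝ → ℝ, MarkovRenewal.SlowlyVarying L →
      (∀ α : ℝ, 0 ≤ α → α < 1 → (∀ t : ℝ, 0 < t → 1 - cdf m t = t ^ (-α) * L t) →
        ((fun t : ℝ => (MarkovRenewal.renewalMeasure g η l₀ t A).toReal) ~[atTop]
          fun t : ℝ => t ^ α / L t *
            (Real.sinc (Real.pi * α) / ∫ l, (l : ℝ) ^ (-α) ∂ρ) * ρ.real A) ∧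
        ((fun t : ℝ => (MarkovRenewal.renewalMeasure g η l₀ t A).toReal) ~[atTop]
          fun t : ℝ => Real.sinc (Real.pi * α) / (1 - cdf m t) *
            (ρ.real A / ∫ l, (l : ℝ) ^ (-α) ∂ρ))) ∧
      ((∀ t : ℝ, 0 < t → 1 - cdf m t = t ^ (-1 : ℝ) * L t) →
        MarkovRenewal.SlowlyVarying (fun t => ∫ s in (0 : ℝ)..t, (1 - cdf m s)) ∧
        ((fun t : ℝ => (MarkovRenewal.renewalMeasure g η l₀ t A).toReal) ~[atTop]
          fun t : ℝ => t / (∫ s in (0 : ℝ)..t, (1 - cdf m s)) *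
            (ρ.real A / ∫ l, (l : ℝ)⁻¹ ∂ρ)) ∧
        Tendsto (fun t : ℝ => (MarkovRenewal.renewalMeasure g η l₀ t A).toReal * (1 - cdf m t))
          atTop (𝓝 0))) := by
  refine ⟨fun hmean => MarkovRenewal.renewalMeasure_isEquivalent_of_meanWaiting_lt_top hη hHarris
    hρ hA hρA l₀ hmean, ?_⟩
  intro ha m _ hm hsc L hL
  have hρA' : 0 < ρ.real A := ENNReal.toReal_pos hρA.ne' (measure_ne_top _ _)
  have hanti : Antitone fun t => 1 - cdf m t := MarkovRenewal.antitone_one_sub_cdf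
  have hf0 : ∀ t, 0 ≤ 1 - cdf m t := fun t => sub_nonneg.2 (cdf_le_one m t)
  have hf1 : ∀ t, 1 - cdf m t ≤ 1 := fun t => sub_le_self _ (cdf_nonneg m t)
  constructor
  · intro α hα0 hα1 hF
    have hpos : ∀ t, 0 < t → 0 < 1 - cdf m t := fun t ht => by
      rw [hF t ht]
      exact mul_pos (Real.rpow_pos_of_pos ht _) (hL.1 t ht)
    have hfreg : ∀ c : ℝ, 0 < c → Tendsto (fun T => (1 - cdf m (T * c)) / (1 - cdf m T)) atTop
        (𝓝 (c ^ (-α))) := fun c hc =>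
      MarkovRenewal.tendsto_mul_div_of_eq_rpow_mul (f := fun t => 1 - cdf m t) hL hF hc
    have hK := MarkovRenewal.tendsto_intervalIntegral_div hanti hf1 hpos hα0 hα1 hfreg
    have h1α : 0 < 1 - α := by linarith
    have hreg : ∀ c : ℝ, 0 < c → Tendsto (fun T => (∫ u in (0 : ℝ)..(T * c), (1 - cdf m u)) /
        ∫ u in (0 : ℝ)..T, (1 - cdf m u)) atTop (𝓝 (c ^ (1 - α))) := by
      intro c hc
      have hT : Tendsto (fun T : ℝ => T * c) atTop atTop := tendsto_id.atTop_mul_const hc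
      have h2 := (((hK.comp hT).div hK (by positivity)).mul (hfreg c hc)).mul_const c
      rw [div_self (by positivity), one_mul] at h2
      have e : c ^ (-α) * c = c ^ (1 - α) := by
        rw [sub_eq_neg_add, Real.rpow_add hc, Real.rpow_one]
      rw [e] at h2
      refine h2.congr' ?_
      filter_upwards [eventually_gt_atTop 0] with T hT
      have h3 := MarkovRenewal.intervalIntegral_pos_of_antitone hanti hpos hT
      have h4 := hpos T hT
      have h5 := hpos (T * c) (mul_pos hT hc)
      simp only [Pi.div_apply, Function.comp]
      field_simp
    have key := MarkovRenewal.tendsto_renewalMeasure_of_scaledType hη.nonneg hHarris hρ hA ha hm hsc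
      hpos hα0 hα1.le hreg l₀
    have hI := MarkovRenewal.integral_rpow_neg_pos ha (ρ := ρ) hα0
    have hsinc := MarkovRenewal.Gamma_one_add_mul_Gamma_one_sub hα0 hα1
    have hΓ1 : 0 < Real.Gamma (1 + α) := Real.Gamma_pos_of_pos (by linarith)
    have hΓ2 : 0 < Real.Gamma (1 - α) := Real.Gamma_pos_of_pos h1α
    have hlim : Tendsto (fun T => (1 - cdf m T) *
        (MarkovRenewal.renewalMeasure g η l₀ T A).toReal) atTop
        (𝓝 (Real.sinc (Real.pi * α) * (ρ.real A / ∫ l, (l : ℝ) ^ (-α) ∂ρ))) := by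
      have h2 := key.div hK (by positivity)
      have e : ρ.real A / (∫ l : Set.Icc a b, (l : ℝ) ^ (-α) ∂ρ) / Real.Gamma (1 + α) /
          Real.Gamma (2 - α) / (1 - α)⁻¹ =
          Real.sinc (Real.pi * α) * (ρ.real A / ∫ l, (l : ℝ) ^ (-α) ∂ρ) := by
        rw [show 2 - α = (1 - α) + 1 by ring, Real.Gamma_add_one h1α.ne', ← hsinc]
        field_simp
      rw [e] at h2
      refine h2.congr' ?_
      filter_upwards [eventually_gt_atTop 0] with T hT
      have h3 := MarkovRenewal.intervalIntegral_pos_of_antitone hanti hpos hT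
      have h4 := hpos T hT
      simp only [Pi.div_apply]
      field_simp
    have hne : Real.sinc (Real.pi * α) * (ρ.real A / ∫ l : Set.Icc a b, (l : ℝ) ^ (-α) ∂ρ) ≠ 0 := by
      rw [← hsinc]
      positivity
    constructor
    · refine MarkovRenewal.isEquivalent_of_tendsto_mul hne hlim ?_
      filter_upwards [eventually_gt_atTop 0] with T hT
      have h3 := hL.1 T hT
      have h4 : 0 < T ^ α := Real.rpow_pos_of_pos hT _
      rw [hF T hT, Real.rpow_neg hT.le]
      field_simp
    · refine MarkovRenewal.isEquivalent_of_tendsto_mul hne hlim ?_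
      filter_upwards [eventually_gt_atTop 0] with T hT
      have h3 := hpos T hT
      field_simp
  · intro hF
    have hpos : ∀ t, 0 < t → 0 < 1 - cdf m t := fun t ht => by
      rw [hF t ht]
      exact mul_pos (Real.rpow_pos_of_pos ht _) (hL.1 t ht)
    have hTL : ∀ T, 0 < T → T * (1 - cdf m T) = L T := fun T hT => by
      rw [hF T hT, Real.rpow_neg_one, ← mul_assoc, mul_inv_cancel₀ hT.ne', one_mul]
    have h0 := MarkovRenewal.tendsto_mul_div_intervalIntegral hanti hpos (by
      intro c hc
      refine (hL.2 c hc).congr' ?_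
      filter_upwards [eventually_gt_atTop 0] with T hT
      rw [hTL T hT, hTL _ (mul_pos hT hc), mul_comm T c])
    have hreg : ∀ c : ℝ, 0 < c → Tendsto (fun T => (∫ u in (0 : ℝ)..(T * c), (1 - cdf m u)) /
        ∫ u in (0 : ℝ)..T, (1 - cdf m u)) atTop (𝓝 1) := fun c hc =>
      MarkovRenewal.tendsto_intervalIntegral_scale_of_tendsto_zero hanti hf0 hpos h0 hc
    have key := MarkovRenewal.tendsto_renewalMeasure_of_scaledType hη.nonneg hHarris hρ hA ha hm hsc
      hpos zero_le_one le_rfl (by simpa using hreg) l₀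
    have hI := MarkovRenewal.integral_rpow_neg_pos ha (ρ := ρ) zero_le_one
    rw [show (1 : ℝ) + 1 = 2 by norm_num, show (2 : ℝ) - 1 = 1 by norm_num,
      Real.Gamma_two, Real.Gamma_one, div_one, div_one] at key
    simp_rw [Real.rpow_neg_one] at key hI
    refine ⟨⟨fun t ht => MarkovRenewal.intervalIntegral_pos_of_antitone hanti hpos ht,
      fun c hc => by simpa only [mul_comm c] using hreg c hc⟩, ?_, ?_⟩
    · refine MarkovRenewal.isEquivalent_of_tendsto_mul (by positivity) key ?_
      filter_upwards [eventually_gt_atTop 0] with T hT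
      have h3 := MarkovRenewal.intervalIntegral_pos_of_antitone hanti hpos hT
      field_simp
    · have h2 := key.mul h0
      rw [mul_zero] at h2
      refine h2.congr' ?_
      filter_upwards [eventually_gt_atTop 0] with T hT
      have h3 := MarkovRenewal.intervalIntegral_pos_of_antitone hanti hpos hT
      field_simp
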